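/- **Setting.** Fix $N$ and write $B_j=\{y\in\mathbb R^N: |y|\le j\}$, $j=1,2,\dots$ A *b-measure* is a map $\mu$ from the ring $\mathcal B$ of bounded Borel subsets of $\mathbb R$ to $\mathbb R$ with $\mu(\emptyset)=0$, $\mu(\{t\})=0$ for all $t\in\mathbb R$, and $\mu(\bigcup_n A_n)=\sum_n\mu(A_n)$ for pairwise disjoint $A_n\in\mathcal B$ with $\bigcup_n A_n\in\mathcal B$; its total variation is $|\mu|(A)=\sup\sum_i|\mu(A_i)|$ over finite partitions of $A$ into sets of $\mathcal B$. Let $\mathcal M_c^+$ be the set of locally finite positive Borel measures on $\mathbb R$ without atoms, and let $\omega_1\le\omega_2\le\cdots$ be continuous non-decreasing functions $[0,\infty)\to[0,\infty)$ with $\omega_j(0)=0$. A *parametric b-measure* is a family $\nu=(\nu_y)_{y\in\mathbb R^N}$ of b-measures such that for each $j\ge1$ there are $m_j,l_j\in\mathcal M_c^+$ (an *$m$-bound* and an *$l$-bound* of $\nu$ on $B_j$) with $$|\nu_y|(A)\le m_j(A),\qquad |\nu_{y_1}-\nu_{y_2}|(A)\le l_j(A)\,\omega_j(|y_1-y_2|)\qquad(A\in\mathcal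 B,\ y,y_1,y_2\in B_j).$$ The vector space of these is denoted $\mathfrak M_p$. For $y(\cdot)$ continuous on $[a,b]$, $\int_a^b d\nu_{y(s)}$ is the limit of the Riemann sums $\sum_i\nu_{y(\tau_i)}([t_i,t_{i+1}])$, $\tau_i\in[t_i,t_{i+1}]$, as the mesh of the partition tends to $0$ (this limit exists). In what follows $I=[q_1,q_2]$ with rational $q_1<q_2$. For $D\subset\mathbb R^N$ countable and dense, $\sigma_D$ is the topology on $\mathfrak M_p$ generated by the seminorms $\nu\mapsto|\nu_y(I)|$, $y\in D$. Let $\Theta=\{\theta_j^I\}$ be a family of continuous non-decreasing functions $[0,\infty)\to[0,\infty)$ with $\theta^I_j(0)=0$ and $\theta^{I_1}_{j_1}\le\theta^{I_2}_{j_2}$ whenever $I_1\subseteq I_2$, $j_1\le j_2$; $\sigma_\Theta$ is the topology generated by the seminorms $\nu\mapsto\sup_{y(\cdot)}\big|\int_I d\nu_{y(s)}\big|$, the supremum being over the continuous $y:I\to B_j$ with $|y(t_1)-y(t_2)|\le\theta_j^I(|t_1-t_2|)$ for all $t_1,t_2\in I$. A set $E\subset\mathfrak M_p$ *has equicontinuous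 $m$-bounds* if one can choose $m$-bounds $m_j^\nu$ of each $\nu\in E$ such that for every $j$ and $\varepsilon>0$ there is $\delta>0$ with $m_j^\nu([s,t])<\varepsilon$ whenever $0\le t-s<\delta$ and $\nu\in E$. It *has bounded $l$-bounds* if one can choose $l$-bounds $l_j^\nu$ of each $\nu\in E$ such that for every $j$ there is $c>0$ with $l_j^\nu([t,t+1])\le c$ for all $t\in\mathbb R$, $\nu\in E$. **Theorem.** Let $\mathcal T$ be one of the topologies $\sigma_D$, $\sigma_\Theta$ on $\mathfrak M_p$. (a) If $E\subset\mathfrak M_p$ has equicontinuous $m$-bounds and bounded $l$-bounds, then the closure of $E$ in $(\mathfrak M_p,\mathcal T)$ is compact. (b) Let $(g_\alpha)_{\alpha\in\Gamma}$ be a family of maps $g_\alpha:\mathbb R^N\times\mathbb R\to\mathbb R^N$, Lebesgue measurable in $t$ for each $y$ and continuous in $y$ for a.e. $t$. Suppose that for all $j\ge 1$ and $\alpha$ there are nonnegative locally integrable $\tilde m_j^\alpha,\tilde l_j^\alpha:\mathbb R\to\mathbb R$ such that, for a.e. $t$, $|g_\alpha(y,t)|\le\tilde m_j^\alpha(t)$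 and $|g_\alpha(y_1,t)-g_\alpha(y_2,t)|\le\tilde l_j^\alpha(t)\,\omega_j(|y_1-y_2|)$ for all $y,y_1,y_2\in B_j$ (for $\omega_j=\mathrm{id}$ this is the usual Lipschitz-type Carathéodory condition), and that for each $j$: for every $\varepsilon>0$ there is $\delta>0$ with $\int_s^{s+h}\tilde m_j^\alpha\,dt<\varepsilon$ for all $\alpha\in\Gamma$, $s\in\mathbb R$, $0\le h<\delta$; and there is $c>0$ with $\int_s^{s+1}\tilde l_j^\alpha\,dt\le c$ for all $\alpha\in\Gamma$, $s\in\mathbb R$. Then the formulas $(\nu^{\alpha,i})_y(A)=\int_A (g_\alpha)_i(y,t)\,dt$, $A\in\mathcal B$, define elements $\nu^{\alpha,i}\in\mathfrak M_p$ for $\alpha\in\Gamma$, $1\le i\le N$, and the closure of $\{(\nu^{\alpha,1},\dots,\nu^{\alpha,N}):\alpha\in\Gamma\}$ in $\mathfrak M_p^{\,N}$, with the product topology of $\mathcal T$, is compact. -/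

import Mathlib

open MeasureTheory Set Filter Topology
open scoped NNReal ENNReal

noncomputable section

/-! ### b-measures -/

/-- The ring of bounded Borel subsets of the real line. -/
def IsBddBorel (A : Set ℝ) : Prop := MeasurableSet A ∧ Bornology.IsBounded A

/-- The vector space of continuous real b-measures: countably additive real set functions on the
ring of bounded Borel sets that vanish on points. As for Mathlib's vector measures, the set
function is given the value `0` off its domain, so that two b-measures are equal if and only if
they agree on bounded Borel sets. -/
def bMeasureSubmodule : Submodule ℝ (Set ℝ → ℝ) where
  carrier := {μ |
    (∀ A, ¬ IsBddBorel A → μ A = 0) ∧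
    μ ∅ = 0 ∧
    (∀ A : ℕ → Set ℝ, (∀ n, IsBddBorel (A n)) → Pairwise (fun m n => Disjoint (A m) (A n)) →
      IsBddBorel (⋃ n, A n) → HasSum (fun n => μ (A n)) (μ (⋃ n, A n))) ∧
    ∀ t : ℝ, μ {t} = 0}
  zero_mem' := ⟨fun _ _ => rfl, rfl, fun _ _ _ _ => hasSum_zero, fun _ => rfl⟩
  add_mem' := by
    rintro μ₁ μ₂ ⟨a₁, b₁, c₁, d₁⟩ ⟨a₂, b₂, c₂, d₂⟩
    refine ⟨fun A hA => ?_, ?_, fun A h1 h2 h3 => ?_, fun t => ?_⟩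
    · simp [a₁ A hA, a₂ A hA]
    · simp [b₁, b₂]
    · exact (c₁ A h1 h2 h3).add (c₂ A h1 h2 h3)
    · simp [d₁ t, d₂ t]
  smul_mem' := by
    rintro c μ ⟨a₁, b₁, c₁, d₁⟩
    refine ⟨fun A hA => ?_, ?_, fun A h1 h2 h3 => ?_, fun t => ?_⟩
    · simp [a₁ A hA]
    · simp [b₁]
    · exact (c₁ A h1 h2 h3).mul_left c
    · simp [d₁ t]

/-- The type of (continuous real) b-measures. -/
def BMeasure : Type := ↥bMeasureSubmodule

instance : AddCommGroup BMeasure := inferInstanceAs (AddCommGroup ↥bMeasureSubmodule)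
instance : Module ℝ BMeasure := inferInstanceAs (Module ℝ ↥bMeasureSubmodule)
instance : CoeFun BMeasure (fun _ => Set ℝ → ℝ) := ⟨Subtype.val⟩

theorem BMeasure.add_apply (μ₁ μ₂ : BMeasure) (A : Set ℝ) : (μ₁ + μ₂) A = μ₁ A + μ₂ A := rfl

theorem BMeasure.smul_apply (c : ℝ) (μ : BMeasure) (A : Set ℝ) : (c • μ) A = c * μ A := rfl

theorem BMeasure.sub_apply (μ₁ μ₂ : BMeasure) (A : Set ℝ) : (μ₁ - μ₂) A = μ₁ A - μ₂ A := rfl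

theorem BMeasure.zero_apply (A : Set ℝ) : (0 : BMeasure) A = 0 := rfl

/-- The total variation `|μ|(A)`: the supremum of `∑ |μ (P i)|` over the finite partitions of `A`
into bounded Borel sets. -/
def BMeasure.variation (μ : BMeasure) (A : Set ℝ) : ℝ≥0∞ :=
  ⨆ (n : ℕ) (P : Fin n → Set ℝ)
    (_ : (∀ i, IsBddBorel (P i)) ∧ Pairwise (fun i k => Disjoint (P i) (P k)) ∧ ⋃ i, P i = A),
    ∑ i, ENNReal.ofReal |μ (P i)|

theorem BMeasure.le_variation (μ : BMeasure) {A : Set ℝ} (hA : IsBddBorel A) :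
    ENNReal.ofReal |μ A| ≤ μ.variation A := by
  refine le_iSup_of_le 1 (le_iSup_of_le (fun _ => A) (le_iSup_of_le ⟨fun _ => hA, ?_, ?_⟩ ?_))
  · exact Subsingleton.pairwise
  · exact iUnion_const A
  · simp

theorem BMeasure.variation_zero (A : Set ℝ) : (0 : BMeasure).variation A = 0 := by
  simp [BMeasure.variation, BMeasure.zero_apply]

theorem BMeasure.variation_add_le (μ₁ μ₂ : BMeasure) (A : Set ℝ) :
    (μ₁ + μ₂).variation A ≤ μ₁.variation A + μ₂.variation A := by
  refine iSup_le fun n => iSup_le fun P => iSup_le fun hP => ?_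
  calc ∑ i, ENNReal.ofReal |(μ₁ + μ₂) (P i)|
      ≤ ∑ i, (ENNReal.ofReal |μ₁ (P i)| + ENNReal.ofReal |μ₂ (P i)|) := by
        refine Finset.sum_le_sum fun i _ => ?_
        rw [← ENNReal.ofReal_add (abs_nonneg _) (abs_nonneg _)]
        exact ENNReal.ofReal_le_ofReal (abs_add_le _ _)
    _ = ∑ i, ENNReal.ofReal |μ₁ (P i)| + ∑ i, ENNReal.ofReal |μ₂ (P i)| :=
        Finset.sum_add_distrib
    _ ≤ _ := add_le_add
        (le_iSup_of_le n (le_iSup_of_le P (le_iSup (fun _ => ∑ i, ENNReal.ofReal |μ₁ (P i)|) hP)))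
        (le_iSup_of_le n (le_iSup_of_le P (le_iSup (fun _ => ∑ i, ENNReal.ofReal |μ₂ (P i)|) hP)))

theorem BMeasure.variation_smul_le (c : ℝ) (μ : BMeasure) (A : Set ℝ) :
    (c • μ).variation A ≤ ENNReal.ofReal |c| * μ.variation A := by
  refine iSup_le fun n => iSup_le fun P => iSup_le fun hP => ?_
  calc ∑ i, ENNReal.ofReal |(c • μ) (P i)|
      = ENNReal.ofReal |c| * ∑ i, ENNReal.ofReal |μ (P i)| := by
        rw [Finset.mul_sum]
        refine Finset.sum_congr rfl fun i _ => ?_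
        rw [BMeasure.smul_apply, abs_mul, ENNReal.ofReal_mul (abs_nonneg _)]
    _ ≤ _ := by
        gcongr
        exact le_iSup_of_le n (le_iSup_of_le P (le_iSup (fun _ => ∑ i, ENNReal.ofReal |μ (P i)|) hP))

/-! ### Parametric b-measures -/

/-- Positive Borel measures on the real line that are finite on compact sets (hence regular) and
have no purely discontinuous part, i.e. no atoms. -/
def IsContinuousMeasure (m : Measure ℝ) : Prop := IsLocallyFiniteMeasure m ∧ ∀ t : ℝ, m {t} = 0

/-- A non-decreasing family `ω₁ ≤ ω₂ ≤ …` of moduli of continuity. -/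
structure ModulusFamily where
  toFun : ℕ+ → ℝ≥0 → ℝ≥0
  continuous : ∀ j, Continuous (toFun j)
  monotone : ∀ j, Monotone (toFun j)
  zero : ∀ j, toFun j 0 = 0
  le_of_le : ∀ ⦃i j : ℕ+⦄, i ≤ j → ∀ r, toFun i r ≤ toFun j r

instance : CoeFun ModulusFamily (fun _ => ℕ+ → ℝ≥0 → ℝ≥0) := ⟨ModulusFamily.toFun⟩

/-- `m` is an `m`-bound of `ν` on the closed ball of radius `j`. -/
def IsMBound {N : ℕ} (ν : EuclideanSpace ℝ (Fin N) → BMeasure) (j : ℕ+) (m : Measure ℝ) : Prop :=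
  IsContinuousMeasure m ∧
    ∀ A, IsBddBorel A → ∀ y, ‖y‖ ≤ (j : ℝ) → (ν y).variation A ≤ m A

/-- `l` is an `l`-bound of `ν` on the closed ball of radius `j`. -/
def IsLBound {N : ℕ} (ω : ModulusFamily) (ν : EuclideanSpace ℝ (Fin N) → BMeasure) (j : ℕ+)
    (l : Measure ℝ) : Prop :=
  IsContinuousMeasure l ∧
    ∀ A, IsBddBorel A → ∀ y₁ y₂, ‖y₁‖ ≤ (j : ℝ) → ‖y₂‖ ≤ (j : ℝ) →
      (ν y₁ - ν y₂).variation A ≤ l A * (ω j (nndist y₁ y₂) : ℝ≥0∞)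

theorem IsContinuousMeasure.zero : IsContinuousMeasure 0 :=
  ⟨inferInstance, fun _ => rfl⟩

theorem IsContinuousMeasure.add {m₁ m₂ : Measure ℝ} (h₁ : IsContinuousMeasure m₁)
    (h₂ : IsContinuousMeasure m₂) : IsContinuousMeasure (m₁ + m₂) := by
  have := h₁.1; have := h₂.1
  refine ⟨⟨fun x => ?_⟩, fun x => by simp [h₁.2 x, h₂.2 x]⟩
  obtain ⟨s, hs, hs'⟩ := m₁.finiteAt_nhds x
  obtain ⟨t, ht, ht'⟩ := m₂.finiteAt_nhds x
  refine ⟨s ∩ t, inter_mem hs ht, ?_⟩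
  rw [Measure.add_apply]
  exact ENNReal.add_lt_top.2 ⟨(measure_mono inter_subset_left).trans_lt hs',
    (measure_mono inter_subset_right).trans_lt ht'⟩

theorem IsContinuousMeasure.smul {m : Measure ℝ} (h : IsContinuousMeasure m) (c : ℝ≥0) :
    IsContinuousMeasure ((c : ℝ≥0∞) • m) := by
  have := h.1
  refine ⟨⟨fun x => ?_⟩, fun x => by simp [h.2 x]⟩
  obtain ⟨s, hs, hs'⟩ := m.finiteAt_nhds x
  refine ⟨s, hs, ?_⟩
  rw [Measure.smul_apply, smul_eq_mul]
  exact ENNReal.mul_lt_top ENNReal.coe_lt_top hs'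

/-- The vector space of parametric b-measures on `ℝ^N` with respect to the moduli `ω`. -/
def paramBMeasureSubmodule (N : ℕ) (ω : ModulusFamily) :
    Submodule ℝ (EuclideanSpace ℝ (Fin N) → BMeasure) where
  carrier := {ν | ∀ j : ℕ+, ∃ m l : Measure ℝ, IsMBound ν j m ∧ IsLBound ω ν j l}
  zero_mem' := fun j => ⟨0, 0,
    ⟨IsContinuousMeasure.zero, fun A _ y _ => by simp [BMeasure.variation_zero]⟩,
    ⟨IsContinuousMeasure.zero, fun A _ y₁ y₂ _ _ => by simp [BMeasure.variation_zero]⟩⟩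
  add_mem' := by
    intro ν₁ ν₂ h₁ h₂ j
    obtain ⟨m₁, l₁, hm₁, hl₁⟩ := h₁ j
    obtain ⟨m₂, l₂, hm₂, hl₂⟩ := h₂ j
    refine ⟨m₁ + m₂, l₁ + l₂, ⟨hm₁.1.add hm₂.1, fun A hA y hy => ?_⟩,
      ⟨hl₁.1.add hl₂.1, fun A hA y₁ y₂ hy₁ hy₂ => ?_⟩⟩
    · exact (BMeasure.variation_add_le _ _ _).trans
        (add_le_add (hm₁.2 A hA y hy) (hm₂.2 A hA y hy))
    · have e : (ν₁ + ν₂) y₁ - (ν₁ + ν₂) y₂ = (ν₁ y₁ - ν₁ y₂) + (ν₂ y₁ - ν₂ y₂) := by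
        simp only [Pi.add_apply]; abel
      rw [e, Measure.add_apply, add_mul]
      exact (BMeasure.variation_add_le _ _ _).trans
        (add_le_add (hl₁.2 A hA y₁ y₂ hy₁ hy₂) (hl₂.2 A hA y₁ y₂ hy₁ hy₂))
  smul_mem' := by
    intro c ν h j
    obtain ⟨m, l, hm, hl⟩ := h j
    refine ⟨(|c|.toNNReal : ℝ≥0∞) • m, (|c|.toNNReal : ℝ≥0∞) • l,
      ⟨hm.1.smul _, fun A hA y hy => ?_⟩, ⟨hl.1.smul _, fun A hA y₁ y₂ hy₁ hy₂ => ?_⟩⟩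
    · refine (BMeasure.variation_smul_le _ _ _).trans ?_
      rw [Measure.smul_apply, smul_eq_mul]
      exact mul_le_mul_right (hm.2 A hA y hy) _
    · have e : (c • ν) y₁ - (c • ν) y₂ = c • (ν y₁ - ν y₂) := by
        simp only [Pi.smul_apply, smul_sub]
      rw [e, Measure.smul_apply, smul_eq_mul, mul_assoc]
      refine (BMeasure.variation_smul_le _ _ _).trans ?_
      exact mul_le_mul_right (hl.2 A hA y₁ y₂ hy₁ hy₂) _

/-- The type of parametric b-measures on `ℝ^N` with respect to the moduli `ω`. -/
def ParamBMeasure (N : ℕ) (ω : ModulusFamily) : Type := ↥(paramBMeasureSubmodule N ω)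

section
variable {N : ℕ} {ω : ModulusFamily}

instance : AddCommGroup (ParamBMeasure N ω) :=
  inferInstanceAs (AddCommGroup ↥(paramBMeasureSubmodule N ω))
instance : Module ℝ (ParamBMeasure N ω) :=
  inferInstanceAs (Module ℝ ↥(paramBMeasureSubmodule N ω))
instance : CoeFun (ParamBMeasure N ω) (fun _ => EuclideanSpace ℝ (Fin N) → BMeasure) :=
  ⟨Subtype.val⟩

theorem ParamBMeasure.add_apply (ν₁ ν₂ : ParamBMeasure N ω) (y : EuclideanSpace ℝ (Fin N))
    (A : Set ℝ) : (ν₁ + ν₂) y A = ν₁ y A + ν₂ y A := rfl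

theorem ParamBMeasure.smul_apply (c : ℝ) (ν : ParamBMeasure N ω) (y : EuclideanSpace ℝ (Fin N))
    (A : Set ℝ) : (c • ν) y A = c * ν y A := rfl

/-! ### Integration along curves -/

/-- `(τ i, [t i, t (i+1)])`, `i < n`, is a tagged `δ`-partition of `[a, b]`. -/
def IsTaggedPartition (δ a b : ℝ) (n : ℕ) (t τ : ℕ → ℝ) : Prop :=
  t 0 = a ∧ t n = b ∧
    ∀ i < n, t i < t (i + 1) ∧ τ i ∈ Icc (t i) (t (i + 1)) ∧ t (i + 1) - t i < δ

/-- The Riemann sum of `ν` along the curve `y` for a tagged partition. -/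
def riemannSum (ν : ParamBMeasure N ω) (y : ℝ → EuclideanSpace ℝ (Fin N)) (n : ℕ)
    (t τ : ℕ → ℝ) : ℝ :=
  ∑ i ∈ Finset.range n, ν (y (τ i)) (Icc (t i) (t (i + 1)))

/-- `L` is the integral `∫_a^b dν_{y(s)}` of `ν` along the curve `y` (only the values of `y` on
`[a, b]` matter). -/
def HasParamIntegral (ν : ParamBMeasure N ω) (y : ℝ → EuclideanSpace ℝ (Fin N)) (a b L : ℝ) :
    Prop :=
  ∀ ε > 0, ∃ δ > 0, ∀ (n : ℕ) (t τ : ℕ → ℝ), IsTaggedPartition δ a b n t τ →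
    |L - riemannSum ν y n t τ| < ε

open Classical in
/-- The integral `∫_a^b dν_{y(s)}`; it exists whenever `y` is continuous on `[a, b]`, see
`hasParamIntegral_paramIntegral`. -/
def paramIntegral (ν : ParamBMeasure N ω) (y : ℝ → EuclideanSpace ℝ (Fin N)) (a b : ℝ) : ℝ :=
  if h : ∃ L, HasParamIntegral ν y a b L then h.choose else 0

theorem exists_taggedPartition {a b δ : ℝ} (hab : a < b) (hδ : 0 < δ) :
    ∃ (n : ℕ) (t τ : ℕ → ℝ), IsTaggedPartition δ a b n t τ := by
  obtain ⟨n, hn⟩ := exists_nat_gt ((b - a) / δ)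
  have hba : 0 < b - a := sub_pos.2 hab
  have hn0 : (0 : ℝ) < n := (div_pos hba hδ).trans hn
  refine ⟨n, fun i => a + i * ((b - a) / n), fun i => a + i * ((b - a) / n), by simp, ?_, ?_⟩
  · field_simp; ring
  · intro i _
    have h1 : 0 < (b - a) / n := div_pos hba hn0
    have h2 : (b - a) / n < δ := by
      rw [div_lt_iff₀ hδ] at hn; rw [div_lt_iff₀ hn0]; linarith
    push_cast
    refine ⟨by linarith, ⟨le_rfl, by linarith⟩, by linarith⟩

theorem HasParamIntegral.unique {ν : ParamBMeasure N ω} {y : ℝ → EuclideanSpace ℝ (Fin N)}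
    {a b L L' : ℝ} (hab : a < b) (h : HasParamIntegral ν y a b L)
    (h' : HasParamIntegral ν y a b L') : L = L' := by
  by_contra hne
  have hpos : 0 < |L - L'| / 2 := by have := abs_pos.2 (sub_ne_zero.2 hne); linarith
  obtain ⟨δ, hδ, H⟩ := h _ hpos
  obtain ⟨δ', hδ', H'⟩ := h' _ hpos
  obtain ⟨n, t, τ, hP⟩ := exists_taggedPartition hab (lt_min hδ hδ')
  have e1 := H n t τ ⟨hP.1, hP.2.1, fun i hi =>
    ⟨(hP.2.2 i hi).1, (hP.2.2 i hi).2.1, (hP.2.2 i hi).2.2.trans_le (min_le_left _ _)⟩⟩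
  have e2 := H' n t τ ⟨hP.1, hP.2.1, fun i hi =>
    ⟨(hP.2.2 i hi).1, (hP.2.2 i hi).2.1, (hP.2.2 i hi).2.2.trans_le (min_le_right _ _)⟩⟩
  rw [abs_sub_comm] at e2
  have := abs_sub_le L (riemannSum ν y n t τ) L'
  linarith

theorem HasParamIntegral.eq {ν : ParamBMeasure N ω} {y : ℝ → EuclideanSpace ℝ (Fin N)}
    {a b L : ℝ} (hab : a < b) (h : HasParamIntegral ν y a b L) : paramIntegral ν y a b = L := by
  have hex : ∃ L, HasParamIntegral ν y a b L := ⟨L, h⟩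
  rw [paramIntegral, dif_pos hex]
  exact hex.choose_spec.unique hab h

theorem HasParamIntegral.add {ν₁ ν₂ : ParamBMeasure N ω} {y : ℝ → EuclideanSpace ℝ (Fin N)}
    {a b L₁ L₂ : ℝ} (h₁ : HasParamIntegral ν₁ y a b L₁) (h₂ : HasParamIntegral ν₂ y a b L₂) :
    HasParamIntegral (ν₁ + ν₂) y a b (L₁ + L₂) := by
  intro ε hε
  obtain ⟨δ, hδ, H⟩ := h₁ _ (half_pos hε)
  obtain ⟨δ', hδ', H'⟩ := h₂ _ (half_pos hε)
  refine ⟨min δ δ', lt_min hδ hδ', fun n t τ hP => ?_⟩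
  have e1 := H n t τ ⟨hP.1, hP.2.1, fun i hi =>
    ⟨(hP.2.2 i hi).1, (hP.2.2 i hi).2.1, (hP.2.2 i hi).2.2.trans_le (min_le_left _ _)⟩⟩
  have e2 := H' n t τ ⟨hP.1, hP.2.1, fun i hi =>
    ⟨(hP.2.2 i hi).1, (hP.2.2 i hi).2.1, (hP.2.2 i hi).2.2.trans_le (min_le_right _ _)⟩⟩
  have e : riemannSum (ν₁ + ν₂) y n t τ = riemannSum ν₁ y n t τ + riemannSum ν₂ y n t τ := by
    simp only [riemannSum, ParamBMeasure.add_apply, Finset.sum_add_distrib]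
  rw [e, add_sub_add_comm]
  exact (abs_add_le _ _).trans_lt (by linarith)

theorem HasParamIntegral.smul {ν : ParamBMeasure N ω} {y : ℝ → EuclideanSpace ℝ (Fin N)}
    {a b L : ℝ} (c : ℝ) (h : HasParamIntegral ν y a b L) :
    HasParamIntegral (c • ν) y a b (c * L) := by
  intro ε hε
  obtain ⟨δ, hδ, H⟩ := h (ε / (|c| + 1)) (by positivity)
  refine ⟨δ, hδ, fun n t τ hP => ?_⟩
  have e : riemannSum (c • ν) y n t τ = c * riemannSum ν y n t τ := by
    simp only [riemannSum, ParamBMeasure.smul_apply, Finset.mul_sum]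
  have h1 := H n t τ hP
  rw [lt_div_iff₀ (by positivity)] at h1
  rw [e, ← mul_sub, abs_mul]
  nlinarith [abs_nonneg (L - riemannSum ν y n t τ)]

theorem IsBddBorel.subset {A B : Set ℝ} (hB : IsBddBorel B) (hA : MeasurableSet A) (h : A ⊆ B) :
    IsBddBorel A := ⟨hA, hB.2.subset h⟩

theorem isBddBorel_Ioc (a b : ℝ) : IsBddBorel (Ioc a b) :=
  ⟨measurableSet_Ioc, Metric.isBounded_Ioc a b⟩

theorem isBddBorel_Icc (a b : ℝ) : IsBddBorel (Icc a b) :=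
  ⟨measurableSet_Icc, Metric.isBounded_Icc a b⟩

theorem BMeasure.union (μ : BMeasure) {A B : Set ℝ} (hA : IsBddBorel A) (hB : IsBddBorel B)
    (h : Disjoint A B) : μ (A ∪ B) = μ A + μ B := by
  let F : ℕ → Set ℝ := fun n => if n = 0 then A else if n = 1 then B else ∅
  have hU : ⋃ n, F n = A ∪ B := by
    ext x
    simp only [mem_iUnion, mem_union]
    constructor
    · rintro ⟨n, hn⟩
      by_cases h0 : n = 0
      · left; simpa [F, h0] using hn
      · by_cases h1 : n = 1
        · right; simpa [F, h1] using hn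
        · simp [F, h0, h1] at hn
    · rintro (hx | hx)
      · exact ⟨0, by simpa [F] using hx⟩
      · exact ⟨1, by simpa [F] using hx⟩
  have hF : ∀ n, IsBddBorel (F n) := by
    intro n
    by_cases h0 : n = 0
    · simpa [F, h0] using hA
    · by_cases h1 : n = 1
      · simpa [F, h1] using hB
      · simp only [F, h0, h1, if_false]
        exact ⟨MeasurableSet.empty, Bornology.isBounded_empty⟩
  have hd : Pairwise (fun m n => Disjoint (F m) (F n)) := by
    intro m n hmn
    rcases m with _ | _ | m <;> rcases n with _ | _ | n <;> simp_all [F, h.symm]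
  have hs := μ.2.2.2.1 F hF hd (by rw [hU]; exact ⟨hA.1.union hB.1, hA.2.union hB.2⟩)
  rw [hU] at hs
  have hs' : HasSum (fun n => μ (F n)) (∑ n ∈ Finset.range 2, μ (F n)) := by
    refine hasSum_sum_of_ne_finset_zero fun n hn => ?_
    have : F n = ∅ := by
      simp only [Finset.mem_range, not_lt] at hn
      simp only [F]; rw [if_neg (by omega), if_neg (by omega)]
    rw [this]; exact μ.2.2.1
  have := hs.unique hs'
  simpa [Finset.sum_range_succ, F] using this

theorem BMeasure.Icc_eq_Ioc (μ : BMeasure) {a b : ℝ} (h : a ≤ b) : μ (Icc a b) = μ (Ioc a b) := by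
  have e : Icc a b = {a} ∪ Ioc a b := by rw [singleton_union, Ioc_insert_left h]
  rw [e, μ.union ⟨measurableSet_singleton a, Bornology.isBounded_singleton⟩ (isBddBorel_Ioc a b)
    (by simp), show μ {a} = 0 from μ.2.2.2.2 a, zero_add]

theorem measureReal_union_bdd (l : Measure ℝ) [IsLocallyFiniteMeasure l] {A B : Set ℝ}
    (hA : IsBddBorel A) (hB : IsBddBorel B) (h : Disjoint A B) :
    l.real (A ∪ B) = l.real A + l.real B :=
  measureReal_union h hB.1 hA.2.measure_lt_top.ne hB.2.measure_lt_top.ne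

theorem sum_inter_Ioc {f : Set ℝ → ℝ}
    (hf : ∀ A B, IsBddBorel A → IsBddBorel B → Disjoint A B → f (A ∪ B) = f A + f B)
    {J : Set ℝ} (hJ : IsBddBorel J) (t : ℕ → ℝ) (n : ℕ) (ht : ∀ i < n, t i < t (i + 1)) :
    t 0 ≤ t n ∧ f (J ∩ Ioc (t 0) (t n)) = ∑ i ∈ Finset.range n, f (J ∩ Ioc (t i) (t (i + 1))) := by
  have hb : ∀ a b, IsBddBorel (J ∩ Ioc a b) := fun a b =>
    hJ.subset (hJ.1.inter measurableSet_Ioc) inter_subset_left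
  induction n with
  | zero =>
    have h0 : IsBddBorel (∅ : Set ℝ) := ⟨MeasurableSet.empty, Bornology.isBounded_empty⟩
    have := hf ∅ ∅ h0 h0 (disjoint_empty _)
    simp only [union_self] at this
    refine ⟨le_rfl, ?_⟩
    simp only [Ioc_self, inter_empty, Finset.range_zero, Finset.sum_empty]
    linarith
  | succ n ih =>
    obtain ⟨h1, h2⟩ := ih fun i hi => ht i (by omega)
    have h3 := (ht n (by omega)).le
    refine ⟨h1.trans h3, ?_⟩
    rw [Finset.sum_range_succ, ← h2, ← hf _ _ (hb _ _) (hb _ _), ← inter_union_distrib_left,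
      Ioc_union_Ioc_eq_Ioc h1 h3]
    exact Disjoint.mono inter_subset_right inter_subset_right (Ioc_disjoint_Ioc_of_le le_rfl)

theorem IsTaggedPartition.Icc_subset {δ a b : ℝ} {n : ℕ} {t τ : ℕ → ℝ}
    (h : IsTaggedPartition δ a b n t τ) {i : ℕ} (hi : i < n) : Icc (t i) (t (i + 1)) ⊆ Icc a b := by
  have key : ∀ k ≤ n, ∀ i ≤ k, t i ≤ t k := by
    intro k
    induction k with
    | zero => intro _ i hi; rw [Nat.le_zero.1 hi]
    | succ k ih =>
      intro hk i hi
      rcases Nat.lt_or_ge i (k + 1) with h' | h'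
      · exact (ih (by omega) i (by omega)).trans (h.2.2 k (by omega)).1.le
      · rw [le_antisymm hi h']
  refine Icc_subset_Icc ?_ ?_
  · rw [← h.1]; exact key i hi.le 0 (Nat.zero_le _)
  · rw [← h.2.1]; exact key n le_rfl (i + 1) hi

theorem IsTaggedPartition.mono {δ δ' a b : ℝ} {n : ℕ} {t τ : ℕ → ℝ}
    (h : IsTaggedPartition δ a b n t τ) (hδ : δ ≤ δ') : IsTaggedPartition δ' a b n t τ :=
  ⟨h.1, h.2.1, fun i hi => ⟨(h.2.2 i hi).1, (h.2.2 i hi).2.1, (h.2.2 i hi).2.2.trans_le hδ⟩⟩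

theorem abs_sub_apply_le {ν : EuclideanSpace ℝ (Fin N) → BMeasure} {j : ℕ+} {l : Measure ℝ}
    (hl : IsLBound ω ν j l) {A : Set ℝ} (hA : IsBddBorel A) {y₁ y₂ : EuclideanSpace ℝ (Fin N)}
    (h₁ : ‖y₁‖ ≤ (j : ℝ)) (h₂ : ‖y₂‖ ≤ (j : ℝ)) :
    |ν y₁ A - ν y₂ A| ≤ l.real A * ω j (nndist y₁ y₂) := by
  have := hl.1.1
  have h := ((ν y₁ - ν y₂).le_variation hA).trans (hl.2 A hA y₁ y₂ h₁ h₂)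
  have h' := ENNReal.toReal_mono
    (ENNReal.mul_ne_top hA.2.measure_lt_top.ne ENNReal.coe_ne_top) h
  rwa [ENNReal.toReal_ofReal (abs_nonneg _), ENNReal.toReal_mul, ENNReal.coe_toReal] at h'

theorem abs_apply_le {ν : EuclideanSpace ℝ (Fin N) → BMeasure} {j : ℕ+} {m : Measure ℝ}
    (hm : IsMBound ν j m) {A : Set ℝ} (hA : IsBddBorel A) {y : EuclideanSpace ℝ (Fin N)}
    (h : ‖y‖ ≤ (j : ℝ)) : |ν y A| ≤ m.real A := by
  have := hm.1.1
  have h' := ENNReal.toReal_mono hA.2.measure_lt_top.ne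
    (((ν y).le_variation hA).trans (hm.2 A hA y h))
  rwa [ENNReal.toReal_ofReal (abs_nonneg _)] at h'

/-- Two Riemann sums along a curve whose oscillation over distances `< 2 δ` is at most `η`, as
measured by `ω j`, differ by at most `η · l((a, b])`. -/
theorem abs_riemannSum_sub_le (ν : ParamBMeasure N ω) {j : ℕ+} {l : Measure ℝ}
    (hl : IsLBound ω ν j l) {y : ℝ → EuclideanSpace ℝ (Fin N)} {a b δ η : ℝ}
    (hy : ∀ s ∈ Icc a b, ‖y s‖ ≤ (j : ℝ))
    (hη : ∀ s ∈ Icc a b, ∀ s' ∈ Icc a b, |s - s'| < 2 * δ → (ω j (nndist (y s) (y s')) : ℝ) ≤ η)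
    {n n' : ℕ} {t τ t' τ' : ℕ → ℝ} (hP : IsTaggedPartition δ a b n t τ)
    (hP' : IsTaggedPartition δ a b n' t' τ') :
    |riemannSum ν y n t τ - riemannSum ν y n' t' τ'| ≤ η * l.real (Ioc a b) := by
  have := hl.1.1
  set I : ℕ → Set ℝ := fun i => Ioc (t i) (t (i + 1)) with hI
  set I' : ℕ → Set ℝ := fun i => Ioc (t' i) (t' (i + 1)) with hI'
  have hlt := fun i hi => (hP.2.2 i hi).1
  have hlt' := fun i hi => (hP'.2.2 i hi).1
  have sI : ∀ i < n, I i ⊆ Ioc a b := by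
    intro i hi x hx
    have h1 := hP.Icc_subset hi (left_mem_Icc.2 (hlt i hi).le)
    have h2 := hP.Icc_subset hi (right_mem_Icc.2 (hlt i hi).le)
    exact ⟨h1.1.trans_lt hx.1, hx.2.trans h2.2⟩
  have sI' : ∀ i < n', I' i ⊆ Ioc a b := by
    intro i hi x hx
    have h1 := hP'.Icc_subset hi (left_mem_Icc.2 (hlt' i hi).le)
    have h2 := hP'.Icc_subset hi (right_mem_Icc.2 (hlt' i hi).le)
    exact ⟨h1.1.trans_lt hx.1, hx.2.trans h2.2⟩
  have e1 : riemannSum ν y n t τ =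
      ∑ i ∈ Finset.range n, ∑ k ∈ Finset.range n', ν (y (τ i)) (I i ∩ I' k) := by
    refine Finset.sum_congr rfl fun i hi => ?_
    have hi := Finset.mem_range.1 hi
    rw [BMeasure.Icc_eq_Ioc _ (hlt i hi).le,
      ← (sum_inter_Ioc (fun A B => (ν (y (τ i))).union) (isBddBorel_Ioc _ _) t' n' hlt').2,
      hP'.1, hP'.2.1, inter_eq_left.2 (sI i hi)]
  have e2 : riemannSum ν y n' t' τ' =
      ∑ i ∈ Finset.range n, ∑ k ∈ Finset.range n', ν (y (τ' k)) (I i ∩ I' k) := by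
    rw [Finset.sum_comm]
    refine Finset.sum_congr rfl fun k hk => ?_
    have hk := Finset.mem_range.1 hk
    simp_rw [inter_comm _ (I' k)]
    rw [BMeasure.Icc_eq_Ioc _ (hlt' k hk).le,
      ← (sum_inter_Ioc (fun A B => (ν (y (τ' k))).union) (isBddBorel_Ioc _ _) t n hlt).2,
      hP.1, hP.2.1, inter_eq_left.2 (sI' k hk)]
  have e3 : l.real (Ioc a b) =
      ∑ i ∈ Finset.range n, ∑ k ∈ Finset.range n', l.real (I i ∩ I' k) := by
    have hl1 : ∀ A B, IsBddBorel A → IsBddBorel B → Disjoint A B →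
        l.real (A ∪ B) = l.real A + l.real B := fun A B => measureReal_union_bdd l
    have h1 := (sum_inter_Ioc hl1 (isBddBorel_Ioc a b) t n hlt).2
    rw [hP.1, hP.2.1, inter_self] at h1
    rw [h1]
    refine Finset.sum_congr rfl fun i hi => ?_
    have hi := Finset.mem_range.1 hi
    rw [← (sum_inter_Ioc hl1 (isBddBorel_Ioc _ _) t' n' hlt').2, hP'.1, hP'.2.1,
      inter_eq_left.2 (sI i hi), inter_eq_right.2 (sI i hi)]
  rw [e1, e2, e3, ← Finset.sum_sub_distrib, Finset.mul_sum]
  refine (Finset.abs_sum_le_sum_abs _ _).trans (Finset.sum_le_sum fun i hi => ?_)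
  rw [← Finset.sum_sub_distrib, Finset.mul_sum]
  refine (Finset.abs_sum_le_sum_abs _ _).trans (Finset.sum_le_sum fun k hk => ?_)
  have hi := Finset.mem_range.1 hi
  have hk := Finset.mem_range.1 hk
  have m1 := hP.Icc_subset hi (hP.2.2 i hi).2.1
  have m2 := hP'.Icc_subset hk (hP'.2.2 k hk).2.1
  have hB : IsBddBorel (I i ∩ I' k) :=
    (isBddBorel_Ioc _ _).subset (measurableSet_Ioc.inter measurableSet_Ioc) inter_subset_left
  have h := abs_sub_apply_le hl hB (hy _ m1) (hy _ m2)
  rcases (I i ∩ I' k).eq_empty_or_nonempty with h0 | ⟨x, hx, hx'⟩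
  · rw [h0] at h ⊢
    simpa using h
  · refine h.trans ?_
    rw [mul_comm]
    refine mul_le_mul_of_nonneg_right (hη _ m1 _ m2 ?_) measureReal_nonneg
    obtain ⟨-, ⟨p1, p2⟩, p3⟩ := hP.2.2 i hi
    obtain ⟨-, ⟨q1, q2⟩, q3⟩ := hP'.2.2 k hk
    rw [abs_lt]
    constructor <;> linarith [hx.1, hx.2, hx'.1, hx'.2]

/-- A parametric b-measure is integrable along every continuous curve. -/
theorem exists_hasParamIntegral (ν : ParamBMeasure N ω) {y : ℝ → EuclideanSpace ℝ (Fin N)}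
    {a b : ℝ} (hab : a < b) (hy : ContinuousOn y (Icc a b)) :
    ∃ L, HasParamIntegral ν y a b L := by
  obtain ⟨C, hC⟩ := isCompact_Icc.exists_bound_of_continuousOn hy
  obtain ⟨j0, hj0⟩ := exists_nat_ge C
  let j : ℕ+ := j0.succPNat
  have hj : ∀ s ∈ Icc a b, ‖y s‖ ≤ (j : ℝ) := fun s hs => by
    have : ((j : ℕ) : ℝ) = j0 + 1 := by simp [j]
    rw [this]; linarith [hC s hs]
  obtain ⟨m, l, -, hl⟩ := ν.2 j
  have cauchy : ∀ ε > 0, ∃ δ > 0, ∀ (n : ℕ) (t τ : ℕ → ℝ) (n' : ℕ) (t' τ' : ℕ → ℝ),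
      IsTaggedPartition δ a b n t τ → IsTaggedPartition δ a b n' t' τ' →
      |riemannSum ν y n t τ - riemannSum ν y n' t' τ'| < ε := by
    intro ε hε
    set M := l.real (Ioc a b) with hM
    have hM0 : 0 ≤ M := measureReal_nonneg
    have hη : 0 < ε / (M + 1) := by positivity
    have hc : Tendsto (fun r => (ω j r : ℝ)) (𝓝 0) (𝓝 0) := by
      have := (NNReal.continuous_coe.comp (ω.continuous j)).tendsto 0
      simpa [Function.comp_def, ω.zero j] using this
    obtain ⟨ρ, hρ, Hρ⟩ := Metric.eventually_nhds_iff.1 (hc.eventually (gt_mem_nhds hη))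
    obtain ⟨δ, hδ, Hδ⟩ := Metric.uniformContinuousOn_iff.1
      (isCompact_Icc.uniformContinuousOn_of_continuous hy) ρ hρ
    refine ⟨δ / 2, half_pos hδ, fun n t τ n' t' τ' hP hP' => ?_⟩
    refine (abs_riemannSum_sub_le ν hl hj (η := ε / (M + 1)) ?_ hP hP').trans_lt ?_
    · intro s hs s' hs' hss
      refine (Hρ ?_).le
      have := Hδ s hs s' hs' (by rw [Real.dist_eq]; linarith)
      rw [NNReal.dist_eq]
      simpa using this
    · rw [div_mul_eq_mul_div, div_lt_iff₀ (by positivity)]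
      nlinarith
  choose n t τ hP using fun k : ℕ =>
    exists_taggedPartition hab (δ := 1 / ((k : ℝ) + 1)) (by positivity)
  have fine : ∀ δ > 0, ∃ K : ℕ, ∀ k ≥ K, IsTaggedPartition δ a b (n k) (t k) (τ k) := by
    intro δ hδ
    obtain ⟨K, hK⟩ := exists_nat_one_div_lt hδ
    refine ⟨K, fun k hk => (hP k).mono (le_trans ?_ hK.le)⟩
    exact one_div_le_one_div_of_le (by positivity) (by simpa using hk)
  have hS : CauchySeq fun k => riemannSum ν y (n k) (t k) (τ k) := by
    refine Metric.cauchySeq_iff.2 fun ε hε => ?_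
    obtain ⟨δ, hδ, H⟩ := cauchy ε hε
    obtain ⟨K, hK⟩ := fine δ hδ
    exact ⟨K, fun k hk k' hk' => H _ _ _ _ _ _ (hK k hk) (hK k' hk')⟩
  obtain ⟨L, hL⟩ := cauchySeq_tendsto_of_complete hS
  refine ⟨L, fun ε hε => ?_⟩
  obtain ⟨δ, hδ, H⟩ := cauchy (ε / 2) (half_pos hε)
  obtain ⟨K, hK⟩ := fine δ hδ
  refine ⟨δ, hδ, fun n' t' τ' hP' => ?_⟩
  obtain ⟨K', hK'⟩ := Metric.tendsto_atTop.1 hL (ε / 2) (half_pos hε)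
  have h1 := hK' (max K K') (le_max_right _ _)
  have h2 := H _ _ _ _ _ _ (hK (max K K') (le_max_left _ _)) hP'
  rw [Real.dist_eq, abs_sub_comm] at h1
  exact (abs_sub_le _ _ _).trans_lt (by linarith)

theorem hasParamIntegral_paramIntegral (ν : ParamBMeasure N ω)
    {y : ℝ → EuclideanSpace ℝ (Fin N)} {a b : ℝ} (hab : a < b) (hy : ContinuousOn y (Icc a b)) :
    HasParamIntegral ν y a b (paramIntegral ν y a b) := by
  obtain ⟨L, hL⟩ := exists_hasParamIntegral ν hab hy
  rwa [hL.eq hab]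

theorem abs_paramIntegral_le (ν : ParamBMeasure N ω) {j : ℕ+} {m : Measure ℝ}
    (hm : IsMBound ν j m) {y : ℝ → EuclideanSpace ℝ (Fin N)} {a b : ℝ} (hab : a < b)
    (hy : ContinuousOn y (Icc a b)) (hj : ∀ s ∈ Icc a b, ‖y s‖ ≤ (j : ℝ)) :
    |paramIntegral ν y a b| ≤ m.real (Ioc a b) := by
  have := hm.1.1
  refine le_of_forall_pos_le_add fun ε hε => ?_
  obtain ⟨δ, hδ, H⟩ := hasParamIntegral_paramIntegral ν hab hy ε hε
  obtain ⟨n, t, τ, hP⟩ := exists_taggedPartition hab hδ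
  have h1 := H n t τ hP
  have h2 : |riemannSum ν y n t τ| ≤ m.real (Ioc a b) := by
    have h3 := (sum_inter_Ioc (fun A B => measureReal_union_bdd m) (isBddBorel_Ioc a b) t n
      (fun i hi => (hP.2.2 i hi).1)).2
    rw [hP.1, hP.2.1, inter_self] at h3
    rw [h3]
    refine (Finset.abs_sum_le_sum_abs _ _).trans (Finset.sum_le_sum fun i hi => ?_)
    have hi := Finset.mem_range.1 hi
    have hsub : Ioc (t i) (t (i + 1)) ⊆ Ioc a b := by
      intro x hx
      have p1 := hP.Icc_subset hi (left_mem_Icc.2 (hP.2.2 i hi).1.le)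
      have p2 := hP.Icc_subset hi (right_mem_Icc.2 (hP.2.2 i hi).1.le)
      exact ⟨p1.1.trans_lt hx.1, hx.2.trans p2.2⟩
    rw [BMeasure.Icc_eq_Ioc _ (hP.2.2 i hi).1.le, inter_eq_right.2 hsub]
    exact abs_apply_le hm (isBddBorel_Ioc _ _) (hj _ (hP.Icc_subset hi (hP.2.2 i hi).2.1))
  have := abs_sub_abs_le_abs_sub (paramIntegral ν y a b) (riemannSum ν y n t τ)
  linarith

theorem paramIntegral_add (ν₁ ν₂ : ParamBMeasure N ω) {y : ℝ → EuclideanSpace ℝ (Fin N)}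
    {a b : ℝ} (hab : a < b) (hy : ContinuousOn y (Icc a b)) :
    paramIntegral (ν₁ + ν₂) y a b = paramIntegral ν₁ y a b + paramIntegral ν₂ y a b :=
  ((hasParamIntegral_paramIntegral ν₁ hab hy).add
    (hasParamIntegral_paramIntegral ν₂ hab hy)).eq hab

theorem paramIntegral_smul (c : ℝ) (ν : ParamBMeasure N ω) {y : ℝ → EuclideanSpace ℝ (Fin N)}
    {a b : ℝ} (hab : a < b) (hy : ContinuousOn y (Icc a b)) :
    paramIntegral (c • ν) y a b = c * paramIntegral ν y a b :=
  ((hasParamIntegral_paramIntegral ν hab hy).smul c).eq hab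

/-! ### The topologies `σ_D` and `σ_Θ` -/

/-- The compact intervals `[q₁, q₂]` with rational endpoints `q₁ < q₂`. -/
structure RatInterval where
  left : ℚ
  right : ℚ
  lt : left < right

/-- The interval as a set of real numbers. -/
def RatInterval.set (I : RatInterval) : Set ℝ := Icc (I.left : ℝ) (I.right : ℝ)

theorem RatInterval.lt_real (I : RatInterval) : (I.left : ℝ) < (I.right : ℝ) :=
  Rat.cast_lt.2 I.lt

/-- A suitable set of moduli of continuity `Θ = {θ_j^I}`. -/
structure SuitableModuli where
  toFun : RatInterval → ℕ+ → ℝ≥0 → ℝ≥0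
  continuous : ∀ I j, Continuous (toFun I j)
  monotone : ∀ I j, Monotone (toFun I j)
  zero : ∀ I j, toFun I j 0 = 0
  le_of_le : ∀ ⦃I₁ I₂ : RatInterval⦄ ⦃j₁ j₂ : ℕ+⦄, I₁.set ⊆ I₂.set → j₁ ≤ j₂ →
    ∀ r, toFun I₁ j₁ r ≤ toFun I₂ j₂ r

instance : CoeFun SuitableModuli (fun _ => RatInterval → ℕ+ → ℝ≥0 → ℝ≥0) :=
  ⟨SuitableModuli.toFun⟩

/-- The set `K_j^I` of continuous curves `I → B_j` with modulus of continuity `θ_j^I`. -/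
def SuitableModuli.curves (Θ : SuitableModuli) (N : ℕ) (I : RatInterval) (j : ℕ+) :
    Set (ℝ → EuclideanSpace ℝ (Fin N)) :=
  {y | ContinuousOn y I.set ∧ (∀ s ∈ I.set, ‖y s‖ ≤ (j : ℝ)) ∧
    ∀ s₁ ∈ I.set, ∀ s₂ ∈ I.set, nndist (y s₁) (y s₂) ≤ Θ I j (nndist s₁ s₂)}

theorem bddAbove_paramIntegral (Θ : SuitableModuli) (I : RatInterval) (j : ℕ+)
    (ν : ParamBMeasure N ω) :
    BddAbove (range fun y : Θ.curves N I j => |paramIntegral ν y.1 I.left I.right|) := by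
  obtain ⟨m, -, hm, -⟩ := ν.2 j
  refine ⟨m.real (Ioc (I.left : ℝ) I.right), ?_⟩
  rintro _ ⟨y, rfl⟩
  exact abs_paramIntegral_le ν hm I.lt_real y.2.1 y.2.2.1

/-- The seminorm `p_{I,y}(ν) = |∫_I dν_y| = |ν_y(I)|`. -/
def seminormD (y : EuclideanSpace ℝ (Fin N)) (I : RatInterval) :
    Seminorm ℝ (ParamBMeasure N ω) :=
  Seminorm.of (fun ν => |ν y I.set|)
    (fun ν₁ ν₂ => by rw [ParamBMeasure.add_apply]; exact abs_add_le _ _)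
    (fun c ν => by rw [ParamBMeasure.smul_apply, abs_mul, Real.norm_eq_abs])

/-- The seminorm `p_{I,j}(ν) = sup_{y ∈ K_j^I} |∫_I dν_{y(s)}|`. -/
def seminormTheta (Θ : SuitableModuli) (I : RatInterval) (j : ℕ+) :
    Seminorm ℝ (ParamBMeasure N ω) :=
  Seminorm.of (fun ν => ⨆ y : Θ.curves N I j, |paramIntegral ν y.1 I.left I.right|)
    (fun ν₁ ν₂ => by
      refine Real.iSup_le (fun y => ?_) (add_nonneg (Real.iSup_nonneg fun _ => abs_nonneg _)
        (Real.iSup_nonneg fun _ => abs_nonneg _))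
      rw [paramIntegral_add _ _ I.lt_real y.2.1]
      exact (abs_add_le _ _).trans (add_le_add (le_ciSup (bddAbove_paramIntegral Θ I j ν₁) y)
        (le_ciSup (bddAbove_paramIntegral Θ I j ν₂) y)))
    (fun c ν => by
      rw [Real.norm_eq_abs, Real.mul_iSup_of_nonneg (abs_nonneg c)]
      refine iSup_congr fun y => ?_
      rw [paramIntegral_smul c ν I.lt_real y.2.1, abs_mul])

/-- The topology on a real vector space generated by a family of seminorms: the coarsest one that
is finer than each of the topologies given by a single seminorm. -/
abbrev seminormTopology {V ι : Type*} [AddCommGroup V] [Module ℝ V] (p : ι → Seminorm ℝ V) :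
    TopologicalSpace V :=
  ⨅ i, (p i).toSeminormedAddCommGroup.toUniformSpace.toTopologicalSpace

/-- The topology `σ_D` on the space of parametric b-measures. -/
abbrev sigmaD (N : ℕ) (ω : ModulusFamily) (D : Set (EuclideanSpace ℝ (Fin N))) :
    TopologicalSpace (ParamBMeasure N ω) :=
  seminormTopology fun q : D × RatInterval => seminormD q.1.1 q.2

/-- The topology `σ_Θ` on the space of parametric b-measures. -/
abbrev sigmaTheta (N : ℕ) (ω : ModulusFamily) (Θ : SuitableModuli) :
    TopologicalSpace (ParamBMeasure N ω) :=
  seminormTopology fun q : RatInterval × ℕ+ => seminormTheta Θ q.1 q.2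

/-- `T` is one of the topologies `σ_D`, with `D` countable and dense in `ℝ^N`, or `σ_Θ`, with `Θ` a
suitable set of moduli of continuity. -/
def IsSigmaTopology (T : TopologicalSpace (ParamBMeasure N ω)) : Prop :=
  (∃ D : Set (EuclideanSpace ℝ (Fin N)), D.Countable ∧ Dense D ∧ T = sigmaD N ω D) ∨
    ∃ Θ : SuitableModuli, T = sigmaTheta N ω Θ

/-! ### Families with equicontinuous `m`-bounds and bounded `l`-bounds -/

/-- A bounded family of measures on the line. -/
def BoundedMeasures {Γ : Type*} (μ : Γ → Measure ℝ) : Prop :=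
  ∃ c : ℝ, 0 < c ∧ ∀ α t, μ α (Icc t (t + 1)) ≤ ENNReal.ofReal c

/-- An equicontinuous family of measures on the line. -/
def EquicontinuousMeasures {Γ : Type*} (μ : Γ → Measure ℝ) : Prop :=
  ∀ ε : ℝ, 0 < ε → ∃ δ : ℝ, 0 < δ ∧ ∀ α s t, 0 ≤ t - s → t - s < δ →
    μ α (Icc s t) < ENNReal.ofReal ε

/-- The set `E` has equicontinuous `m`-bounds. -/
def HasEquicontinuousMBounds (E : Set (ParamBMeasure N ω)) : Prop :=
  ∃ m : E → ℕ+ → Measure ℝ, (∀ ν j, IsMBound ν.1 j (m ν j)) ∧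
    ∀ j, EquicontinuousMeasures fun ν => m ν j

/-- The set `E` has bounded `l`-bounds. -/
def HasBoundedLBounds (E : Set (ParamBMeasure N ω)) : Prop :=
  ∃ l : E → ℕ+ → Measure ℝ, (∀ ν j, IsLBound ω ν.1 j (l ν j)) ∧
    ∀ j, BoundedMeasures fun ν => l ν j

end

/-! ### Carathéodory vector fields -/

/-- `g` is a Carathéodory vector field on `ℝ^N`: it is Lebesgue measurable in `t` for each `y` and
continuous in `y` for almost every `t`, and on the closed ball of radius `j` it has the locally
integrable `m`-bound `m j`, and the locally integrable `l`-bound `l j` with respect to the modulus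
of continuity `ω j` (`ω j = id` being the Lipschitz case). -/
structure IsCaratheodory {N : ℕ} (ω : ModulusFamily)
    (g : EuclideanSpace ℝ (Fin N) → ℝ → EuclideanSpace ℝ (Fin N)) (m l : ℕ+ → ℝ → ℝ) : Prop where
  measurable : ∀ y, AEMeasurable (g y) volume
  continuous : ∀ᵐ t : ℝ, Continuous fun y => g y t
  m_nonneg : ∀ j t, 0 ≤ m j t
  l_nonneg : ∀ j t, 0 ≤ l j t
  m_locallyIntegrable : ∀ j, LocallyIntegrable (m j) volume
  l_locallyIntegrable : ∀ j, LocallyIntegrable (l j) volume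
  m_bound : ∀ j : ℕ+, ∀ᵐ t : ℝ, ∀ y, ‖y‖ ≤ (j : ℝ) → ‖g y t‖ ≤ m j t
  l_bound : ∀ j : ℕ+, ∀ᵐ t : ℝ, ∀ y₁ y₂, ‖y₁‖ ≤ (j : ℝ) → ‖y₂‖ ≤ (j : ℝ) →
    ‖g y₁ t - g y₂ t‖ ≤ l j t * ω j (nndist y₁ y₂)

/-- A family of Carathéodory vector fields has equicontinuous `m`-bounds and bounded `l`-bounds. -/
def IsBoundedCaratheodoryFamily {N : ℕ} (ω : ModulusFamily) {Γ : Type*}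
    (g : Γ → EuclideanSpace ℝ (Fin N) → ℝ → EuclideanSpace ℝ (Fin N)) : Prop :=
  ∃ m l : Γ → ℕ+ → ℝ → ℝ, (∀ α, IsCaratheodory ω (g α) (m α) (l α)) ∧
    (∀ j, ∀ ε : ℝ, 0 < ε → ∃ δ : ℝ, 0 < δ ∧ ∀ α s h, 0 ≤ h → h < δ →
      ∫ t in s..(s + h), m α j t < ε) ∧
    ∀ j, ∃ c : ℝ, 0 < c ∧ ∀ α s, ∫ t in s..(s + 1), l α j t ≤ c

end

noncomputable section

section


/-! ### Compactness and ultrafilters -/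

/-! Both topologies are generated by seminorms, hence regular, and in a regular space the closure of
`E` is compact as soon as every ultrafilter on `E` converges in the whole space.

Along an ultrafilter every bounded real quantity has a limit. The hypotheses bound, uniformly over
`E`, the masses of each interval `Ioc s t` under `ν y`, under the `m`-bounds and under the
`l`-bounds. The limits are additive in the interval, so they are increments of functions `G y`, `F
j`, `H j`, and the inequalities between the masses persist: increments of `G y` are dominated by
those of `F j`, and increments of `G y₁ - G y₂` by `ω j (nndist y₁ y₂)` times those of `H j`.
Equicontinuity makes `F j` continuous. Hence `G y` is continuous, and it is the difference of the
continuous monotone functions `F j + G y` and `F j`; the limit b-measure is the difference of their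
Stieltjes measures. Mere boundedness lets `H j` jump, but the limit b-measures do not charge points,
so the atoms of the measure of `H j` can be deleted and an `l`-bound without atoms remains
(`ParamBMeasure.exists_of_primitives`).

It remains to pass from convergence on intervals, for each fixed `y`, to the topologies. For `σ_D`
this is immediate. For `σ_Θ` the common modulus of the curves and the common bound on the `l`-masses
make the integrals uniformly close to Riemann sums over a single partition, with tag values rounded
to a finite net of the ball; only finitely many interval masses then have to converge
(`tendsto_sigmaTheta`).

For vector fields, the measures with densities `m j` and `l j` are bounds for every component, so
the first part applies to each component, and Tychonoff's theorem gives the product. -/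

theorem isCompact_closure_of_forall_ultrafilter {X : Type*} [TopologicalSpace X] [RegularSpace X]
    {E : Set X} (h : ∀ V : Ultrafilter E, ∃ x, Tendsto Subtype.val (V : Filter E) (𝓝 x)) :
    IsCompact (closure E) := by
  refine isCompact_iff_ultrafilter_le_nhds'.2 fun F hF => ?_
  -- The given ultrafilter `F` lives on `closure E`, not on `E`. Its open members meet `closure E`,
  -- hence `E`, so they trace a proper filter on `E`, which an ultrafilter on `E` refines.
  have hb : NeBot (comap (Subtype.val : E → X)
      (⨅ W : {W : Set X // IsOpen W ∧ W ∈ F}, 𝓟 W.1)) := by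
    have : Nonempty {W : Set X // IsOpen W ∧ W ∈ F} := ⟨⟨univ, isOpen_univ, univ_mem⟩⟩
    refine comap_neBot fun t ht => ?_
    rw [mem_iInf_of_directed] at ht
    · obtain ⟨⟨W, hW, hWF⟩, hWt⟩ := ht
      obtain ⟨x, hxE, hxW⟩ := F.nonempty_of_mem (inter_mem hF hWF)
      obtain ⟨z, hzW, hzE⟩ := mem_closure_iff.1 hxE W hW hxW
      exact ⟨⟨z, hzE⟩, hWt hzW⟩
    · rintro ⟨W₁, h₁, h₁'⟩ ⟨W₂, h₂, h₂'⟩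
      exact ⟨⟨W₁ ∩ W₂, h₁.inter h₂, inter_mem h₁' h₂'⟩,
        principal_mono.2 inter_subset_left, principal_mono.2 inter_subset_right⟩
  obtain ⟨x, hx⟩ := h (@Ultrafilter.of _ _ hb)
  have hxE : x ∈ closure E := mem_closure_of_tendsto hx (Eventually.of_forall fun z => z.2)
  refine ⟨x, hxE, fun C hC => ?_⟩
  obtain ⟨C', hC', hcl, hsub⟩ := exists_mem_nhds_isClosed_subset hC
  refine mem_of_superset ?_ hsub
  -- If the closed neighbourhood `C'` of `x` were not in `F`, its open complement would be, and its
  -- trace would belong to an ultrafilter on `E` that tends to `x`.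
  by_contra hnot
  have hopen : C'ᶜ ∈ F := Ultrafilter.compl_mem_iff_notMem.2 hnot
  have h1 : (Subtype.val : E → X) ⁻¹' C'ᶜ ∈ (Ultrafilter.of (comap (Subtype.val : E → X)
      (⨅ W : {W : Set X // IsOpen W ∧ W ∈ F}, 𝓟 W.1)) : Filter E) :=
    Ultrafilter.of_le _ (preimage_mem_comap
      (mem_iInf_of_mem ⟨C'ᶜ, hcl.isOpen_compl, hopen⟩ (mem_principal_self _)))
  obtain ⟨z, hz1, hz2⟩ := Filter.nonempty_of_mem (inter_mem h1 (hx hC'))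
  exact hz1 hz2

theorem Ultrafilter.exists_tendsto_of_abs_le {ι : Type*} (V : Ultrafilter ι) (f : ι → ℝ) (C : ℝ)
    (h : ∀ i, |f i| ≤ C) : ∃ L, Tendsto f V (𝓝 L) := by
  obtain ⟨L, -, hL⟩ := (isCompact_Icc (a := -C) (b := C)).ultrafilter_le_nhds' (V.map f)
    (Ultrafilter.mem_map.2 (Eventually.of_forall fun i => abs_le.1 (h i)))
  exact ⟨L, hL⟩

theorem regularSpace_seminormTopology {W ι : Type*} [AddCommGroup W] [Module ℝ W]
    (p : ι → Seminorm ℝ W) : @RegularSpace W (seminormTopology p) :=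
  regularSpace_iInf fun i =>
    let := (p i).toSeminormedAddCommGroup
    inferInstance

theorem tendsto_seminormTopology {W ι α : Type*} [AddCommGroup W] [Module ℝ W]
    (p : ι → Seminorm ℝ W) {l : Filter α} {u : α → W} {x : W}
    (h : ∀ i, Tendsto (fun a => p i (u a - x)) l (𝓝 0)) :
    Tendsto u l (@nhds W (seminormTopology p) x) := by
  rw [nhds_iInf, tendsto_iInf]
  intro i
  let := (p i).toSeminormedAddCommGroup
  exact tendsto_iff_norm_sub_tendsto_zero.2 (h i)

/-! ### Primitives of interval functions -/

/-- The primitive, vanishing at `0`, of a function of intervals. -/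
def intervalPrimitive (f : ℝ → ℝ → ℝ) (t : ℝ) : ℝ := if 0 ≤ t then f 0 t else -f t 0

theorem intervalPrimitive_sub {f : ℝ → ℝ → ℝ}
    (hf : ∀ s t u, s ≤ t → t ≤ u → f s u = f s t + f t u) {s t : ℝ} (h : s ≤ t) :
    intervalPrimitive f t - intervalPrimitive f s = f s t := by
  unfold intervalPrimitive
  split_ifs with h1 h2 h2
  · linarith [hf 0 s t h2 h]
  · linarith [hf s 0 t (not_le.1 h2).le h1]
  · linarith
  · linarith [hf s t 0 h (not_le.1 h1).le]

/-! ### Stieltjes measures -/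

/-- The difference `g - f` is itself a Stieltjes function, so the measure of `g` is that of `f` plus
a positive measure. This carries comparisons from intervals to all sets. -/
theorem StieltjesFunction.measure_le_measure {f g : StieltjesFunction ℝ}
    (h : ∀ s t, s ≤ t → f t - f s ≤ g t - g s) : f.measure ≤ g.measure := by
  let d : StieltjesFunction ℝ :=
    { toFun := fun t => g t - f t
      mono' := fun s t hst => by linarith [h s t hst]
      right_continuous' := fun t => (g.right_continuous t).sub (f.right_continuous t) }
  have e : f + d = g := StieltjesFunction.ext fun t => by
    change f t + (g t - f t) = g t
    ring
  rw [← e, StieltjesFunction.measure_add]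
  exact Measure.le_add_right le_rfl

/-- A continuous monotone function as a Stieltjes function. -/
def stieltjesOfContinuous (f : ℝ → ℝ) (hm : Monotone f) (hc : Continuous f) :
    StieltjesFunction ℝ where
  toFun := f
  mono' := hm
  right_continuous' _ := hc.continuousWithinAt

theorem isContinuousMeasure_stieltjes (f : ℝ → ℝ) (hm : Monotone f) (hc : Continuous f) :
    IsContinuousMeasure (stieltjesOfContinuous f hm hc).measure := by
  refine ⟨inferInstance, fun t => ?_⟩
  rw [StieltjesFunction.measure_singleton]
  have : Function.leftLim (stieltjesOfContinuous f hm hc) t = f t :=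
    hc.continuousWithinAt.leftLim_eq
  rw [this]
  simp [stieltjesOfContinuous]

theorem StieltjesFunction.measureReal_Ioc (f : StieltjesFunction ℝ) {s t : ℝ} (h : s ≤ t) :
    f.measure.real (Ioc s t) = f t - f s := by
  rw [measureReal_def, f.measure_Ioc, ENNReal.toReal_ofReal (sub_nonneg.2 (f.mono h))]

/-! ### b-measures from measures -/

theorem IsBddBorel.measure_ne_top {A : Set ℝ} (hA : IsBddBorel A) (m : Measure ℝ)
    [IsLocallyFiniteMeasure m] : m A ≠ ∞ := hA.2.measure_lt_top.ne

open Classical in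
/-- The b-measure given by a set function that is countably additive on bounded Borel sets and
vanishes on points. -/
def BMeasure.mk (f : Set ℝ → ℝ) (h₀ : f ∅ = 0)
    (h : ∀ A : ℕ → Set ℝ, (∀ n, IsBddBorel (A n)) → Pairwise (fun m n => Disjoint (A m) (A n)) →
      IsBddBorel (⋃ n, A n) → HasSum (fun n => f (A n)) (f (⋃ n, A n)))
    (h₁ : ∀ t, f {t} = 0) : BMeasure :=
  ⟨fun A => if IsBddBorel A then f A else 0, fun A hA => if_neg hA, by simp [h₀],
    fun A hA hd hU => by simpa only [if_pos hU, if_pos (hA _)] using h A hA hd hU,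
    fun t => by simp [h₁]⟩

theorem BMeasure.mk_apply {f : Set ℝ → ℝ} {h₀ h h₁} {A : Set ℝ} (hA : IsBddBorel A) :
    BMeasure.mk f h₀ h h₁ A = f A := if_pos hA

/-- A locally finite measure without atoms as a b-measure. -/
def BMeasure.ofMeasure (m : Measure ℝ) (hm : IsContinuousMeasure m) : BMeasure :=
  BMeasure.mk (fun A => m.real A) (by simp)
    (fun A hA hd hU => by
      have := hm.1
      simp only [measureReal_def]
      rw [measure_iUnion hd fun n => (hA n).1]
      have ht : ∑' n, m (A n) ≠ ∞ := by
        rw [← measure_iUnion hd fun n => (hA n).1]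
        exact hU.measure_ne_top m
      rw [ENNReal.tsum_toReal_eq fun n => (hA n).measure_ne_top m]
      exact (ENNReal.summable_toReal ht).hasSum)
    (fun t => by simp [measureReal_def, hm.2 t])

theorem BMeasure.ofMeasure_apply {m : Measure ℝ} (hm : IsContinuousMeasure m) {A : Set ℝ}
    (hA : IsBddBorel A) : BMeasure.ofMeasure m hm A = m.real A := BMeasure.mk_apply hA

/-- A bound for the values on the bounded Borel sets bounds the variation. -/
theorem BMeasure.variation_le {μ : BMeasure} {m : Measure ℝ}
    (h : ∀ A, IsBddBorel A → ENNReal.ofReal |μ A| ≤ m A) (A : Set ℝ) : μ.variation A ≤ m A := by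
  refine iSup_le fun n => iSup_le fun P => iSup_le fun hP => ?_
  rw [← hP.2.2, measure_iUnion hP.2.1 fun i => (hP.1 i).1, tsum_fintype]
  exact Finset.sum_le_sum fun i _ => h _ (hP.1 i)

/-- A difference of Stieltjes measures that is dominated on intervals by a Stieltjes measure is
dominated by it on all bounded Borel sets. -/
theorem abs_measureReal_sub_le {f g h : StieltjesFunction ℝ}
    (H : ∀ s t, s ≤ t → |(f t - f s) - (g t - g s)| ≤ h t - h s) {A : Set ℝ} (hA : IsBddBorel A) :
    |f.measure.real A - g.measure.real A| ≤ h.measure.real A := by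
  -- The absolute value splits into two one-sided bounds, each a comparison of the Stieltjes
  -- measures of `p` and `q + h`.
  have key : ∀ p q : StieltjesFunction ℝ,
      (∀ s t, s ≤ t → |(p t - p s) - (q t - q s)| ≤ h t - h s) →
      p.measure.real A ≤ q.measure.real A + h.measure.real A := by
    intro p q hpq
    have h1 : p.measure ≤ (q + h).measure := StieltjesFunction.measure_le_measure fun s t hst => by
      simp only [StieltjesFunction.add_apply]
      linarith [(abs_le.1 (hpq s t hst)).2]
    rw [StieltjesFunction.measure_add] at h1
    rw [← measureReal_add_apply (hA.measure_ne_top _) (hA.measure_ne_top _)]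
    refine ENNReal.toReal_mono ?_ (h1 A)
    rw [Measure.add_apply]
    exact ENNReal.add_ne_top.2 ⟨hA.measure_ne_top _, hA.measure_ne_top _⟩
  rw [abs_le]
  have h1 := key f g H
  have h2 := key g f fun s t hst => by rw [abs_sub_comm]; exact H s t hst
  constructor <;> linarith

/-- Restricting a locally finite measure to the complement of its countable set of atoms leaves a
measure without atoms. -/
theorem exists_continuous_part (h : Measure ℝ) [IsLocallyFiniteMeasure h] :
    ∃ S : Set ℝ, S.Countable ∧ IsContinuousMeasure (h.restrict Sᶜ) := by
  refine ⟨{t | 0 < h {t}}, ?_, inferInstance, fun t => ?_⟩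
  · exact Measure.countable_meas_pos_of_disjoint_iUnion (fun t => measurableSet_singleton t)
      fun s t hst => by simpa using hst
  · rw [Measure.restrict_apply (measurableSet_singleton t)]
    by_cases ht : 0 < h {t}
    · rw [inter_comm, ← sdiff_eq_compl_inter, sdiff_eq_empty.2 (by simpa using ht), measure_empty]
    · exact measure_mono_null inter_subset_left (by simpa using ht)

/-- As a difference of measures without atoms, `μ` ignores the countable set `S`, so the bound may
be applied to `A \ S`, where `l` and its restriction to `Sᶜ` agree. Thus a dominating measure with
atoms can be replaced by one without. -/
theorem BMeasure.ofReal_abs_le_of_countable {μ : BMeasure} {a b l : Measure ℝ} {S : Set ℝ}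
    (hS : S.Countable) (ha : IsContinuousMeasure a) (hb : IsContinuousMeasure b)
    [IsLocallyFiniteMeasure l] {k : ℝ≥0}
    (hμ : ∀ A, IsBddBorel A → μ A = a.real A - b.real A)
    (h : ∀ A, IsBddBorel A → |μ A| ≤ k * l.real A) {A : Set ℝ} (hA : IsBddBorel A) :
    ENNReal.ofReal |μ A| ≤ l.restrict Sᶜ A * k := by
  have : NullSingletonClass a := ⟨ha.2⟩
  have : NullSingletonClass b := ⟨hb.2⟩
  have hd : IsBddBorel (A \ S) := hA.subset (hA.1.diff hS.measurableSet) sdiff_subset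
  have e : ∀ m : Measure ℝ, [NullSingletonClass m] → m.real A = m.real (A \ S) := fun m _ => by
    rw [measureReal_def, measureReal_def, measure_sdiff_null (hS.measure_zero m)]
  have e1 : μ A = μ (A \ S) := by rw [hμ A hA, hμ _ hd, e a, e b]
  rw [e1, Measure.restrict_apply hA.1, ← Set.sdiff_eq, mul_comm]
  refine (ENNReal.ofReal_le_ofReal (h _ hd)).trans_eq ?_
  rw [ENNReal.ofReal_mul (NNReal.coe_nonneg k), ENNReal.ofReal_coe_nnreal, measureReal_def,
    ENNReal.ofReal_toReal (hd.measure_ne_top l)]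

end

section


/-! ### Parametric b-measures from primitives -/

theorem continuous_of_abs_sub_le {F G : ℝ → ℝ} (hF : Continuous F)
    (h : ∀ s t, s ≤ t → |G t - G s| ≤ F t - F s) : Continuous G := by
  refine continuous_iff_continuousAt.2 fun t => ?_
  have h' : ∀ s, |G s - G t| ≤ |F s - F t| := fun s => by
    rcases le_total s t with hs | hs
    · rw [abs_sub_comm, abs_sub_comm (F s)]
      exact (h s t hs).trans (le_abs_self _)
    · exact (h t s hs).trans (le_abs_self _)
  refine tendsto_iff_dist_tendsto_zero.2 (squeeze_zero (fun _ => dist_nonneg) h' ?_)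
  have := (hF.tendsto t).sub_const (F t)
  simpa using this.abs

/-- Apply the inequality at `s + e` and `t + e` and let `e ↓ 0`: `F` turns into its right-continuous
version, which defines a measure, while `G` is unchanged by continuity. -/
theorem abs_sub_le_mul_rightLim {F G : ℝ → ℝ} (hG : Continuous G) (hF : Monotone F) {k : ℝ}
    (h : ∀ s t, s ≤ t → |G t - G s| ≤ k * (F t - F s)) {s t : ℝ} (hst : s ≤ t) :
    |G t - G s| ≤ k * (hF.stieltjesFunction t - hF.stieltjesFunction s) := by
  have shift : ∀ u : ℝ, Tendsto (fun e : ℝ => u + e) (𝓝[>] 0) (𝓝[>] u) := fun u => by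
    refine tendsto_nhdsWithin_iff.2 ⟨?_, ?_⟩
    · have : Tendsto (fun e : ℝ => u + e) (𝓝 0) (𝓝 (u + 0)) :=
        (continuous_const_add u).tendsto 0
      rw [add_zero] at this
      exact this.mono_left nhdsWithin_le_nhds
    · filter_upwards [self_mem_nhdsWithin] with e he
      simpa using he
  have hFl : ∀ u : ℝ, Tendsto (fun e : ℝ => F (u + e)) (𝓝[>] 0)
      (𝓝 (hF.stieltjesFunction u)) := fun u => (hF.tendsto_rightLim u).comp (shift u)
  have hGl : ∀ u : ℝ, Tendsto (fun e : ℝ => G (u + e)) (𝓝[>] 0) (𝓝 (G u)) := fun u =>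
    (hG.tendsto u).comp ((shift u).mono_right nhdsWithin_le_nhds)
  exact le_of_tendsto_of_tendsto ((hGl t).sub (hGl s)).abs
    (((hFl t).sub (hFl s)).const_mul k)
    (Eventually.of_forall fun e => h _ _ (by linarith))

variable {N : ℕ} {ω : ModulusFamily}

/-- A family of functions on the line, dominated on each ball by continuous monotone functions and
with differences dominated by monotone functions, consists of the primitives of a parametric
b-measure. -/
theorem ParamBMeasure.exists_of_primitives (G : EuclideanSpace ℝ (Fin N) → ℝ → ℝ)
    (F H : ℕ+ → ℝ → ℝ) (hFm : ∀ j, Monotone (F j)) (hFc : ∀ j, Continuous (F j))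
    (hHm : ∀ j, Monotone (H j))
    (hF : ∀ (j : ℕ+) (y), ‖y‖ ≤ (j : ℝ) → ∀ s t, s ≤ t → |G y t - G y s| ≤ F j t - F j s)
    (hH : ∀ (j : ℕ+) (y₁ y₂), ‖y₁‖ ≤ (j : ℝ) → ‖y₂‖ ≤ (j : ℝ) → ∀ s t, s ≤ t →
      |(G y₁ t - G y₁ s) - (G y₂ t - G y₂ s)| ≤ ω j (nndist y₁ y₂) * (H j t - H j s)) :
    ∃ ν : ParamBMeasure N ω, ∀ y s t, s ≤ t → ν y (Ioc s t) = G y t - G y s := by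
  have hJ : ∀ y : EuclideanSpace ℝ (Fin N), ∃ j : ℕ+, ‖y‖ ≤ (j : ℝ) := fun y => by
    obtain ⟨n, hn⟩ := exists_nat_ge ‖y‖
    refine ⟨n.succPNat, hn.trans ?_⟩
    simp
  choose J hJ using hJ
  have hGc : ∀ y, Continuous (G y) := fun y => continuous_of_abs_sub_le (hFc (J y)) (hF _ y (hJ y))
  -- One radius `J y` per point is enough to write `G y` as a difference of continuous monotone
  -- functions. The bounds on every ball are recovered later, because only the increments of `a y -
  -- b y = G y` enter them.
  have ham : ∀ y, Monotone fun t => F (J y) t + G y t := fun y s t hst => by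
    have := (abs_le.1 (hF _ y (hJ y) s t hst)).1
    simp only
    linarith
  have hac : ∀ y, Continuous fun t => F (J y) t + G y t := fun y => (hFc _).add (hGc y)
  let a : EuclideanSpace ℝ (Fin N) → StieltjesFunction ℝ := fun y =>
    stieltjesOfContinuous _ (ham y) (hac y)
  let b : EuclideanSpace ℝ (Fin N) → StieltjesFunction ℝ := fun y =>
    stieltjesOfContinuous _ (hFm (J y)) (hFc (J y))
  have ha : ∀ y, IsContinuousMeasure (a y).measure := fun y => isContinuousMeasure_stieltjes _ _ _
  have hb : ∀ y, IsContinuousMeasure (b y).measure := fun y => isContinuousMeasure_stieltjes _ _ _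
  have hab : ∀ y t, a y t - b y t = G y t := fun y t => by
    change F (J y) t + G y t - F (J y) t = G y t
    ring
  let ν : EuclideanSpace ℝ (Fin N) → BMeasure := fun y =>
    BMeasure.ofMeasure _ (ha y) - BMeasure.ofMeasure _ (hb y)
  have hν : ∀ y A, IsBddBorel A → ν y A = (a y).measure.real A - (b y).measure.real A :=
    fun y A hA => by
      simp only [ν, BMeasure.sub_apply, BMeasure.ofMeasure_apply _ hA]
  refine ⟨⟨ν, fun j => ?_⟩, fun y s t hst => ?_⟩
  -- The `l`-bound is the Stieltjes measure of the right-continuous version of `H j`, stripped of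
  -- its atoms `S`.
  · obtain ⟨S, hS, hSc⟩ := exists_continuous_part (hHm j).stieltjesFunction.measure
    refine ⟨(stieltjesOfContinuous _ (hFm j) (hFc j)).measure, _,
      ⟨isContinuousMeasure_stieltjes _ _ _, fun A _ y hy => ?_⟩, hSc, fun A _ y₁ y₂ h₁ h₂ => ?_⟩
    · refine BMeasure.variation_le (fun B hB => ?_) A
      rw [hν y B hB, ← ENNReal.ofReal_toReal (hB.measure_ne_top _)]
      refine ENNReal.ofReal_le_ofReal (abs_measureReal_sub_le (fun s t hst => ?_) hB)
      have e : a y t - a y s - (b y t - b y s) = G y t - G y s := by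
        rw [← hab, ← hab]; ring
      rw [e]
      exact hF j y hy s t hst
    -- The factor `ω j (nndist y₁ y₂)` is absorbed into the measure, so that the bound has the form
    -- required by `BMeasure.variation_le`.
    · rw [mul_comm, ← smul_eq_mul, ← Measure.smul_apply]
      refine BMeasure.variation_le (fun B hB => ?_) A
      rw [Measure.smul_apply, smul_eq_mul, mul_comm]
      -- Regrouping the four terms exhibits `ν y₁ - ν y₂` as a difference of two positive Stieltjes
      -- measures without atoms.
      have e : ∀ C, IsBddBorel C → (ν y₁ - ν y₂) C =
          (a y₁ + b y₂).measure.real C - (b y₁ + a y₂).measure.real C := fun C hC => by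
        rw [BMeasure.sub_apply, hν _ C hC, hν _ C hC, StieltjesFunction.measure_add,
          StieltjesFunction.measure_add,
          measureReal_add_apply (hC.measure_ne_top _) (hC.measure_ne_top _),
          measureReal_add_apply (hC.measure_ne_top _) (hC.measure_ne_top _)]
        ring
      refine BMeasure.ofReal_abs_le_of_countable hS
        (a := (a y₁ + b y₂).measure) (b := (b y₁ + a y₂).measure)
        (by rw [StieltjesFunction.measure_add]; exact (ha _).add (hb _))
        (by rw [StieltjesFunction.measure_add]; exact (hb _).add (ha _)) e (fun C hC => ?_) hB
      rw [e C hC]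
      have := abs_measureReal_sub_le (f := a y₁ + b y₂) (g := b y₁ + a y₂)
        (h := ω j (nndist y₁ y₂) • (hHm j).stieltjesFunction) (fun s t hst => ?_) hC
      · rwa [StieltjesFunction.measure_smul, measureReal_nnreal_smul_apply] at this
      · have h3 := abs_sub_le_mul_rightLim (G := fun u => G y₁ u - G y₂ u)
          ((hGc y₁).sub (hGc y₂)) (hHm j) (k := ω j (nndist y₁ y₂)) (fun p q hpq => by
            have := hH j y₁ y₂ h₁ h₂ p q hpq
            rwa [sub_sub_sub_comm] at this) hst
        have e2 : (a y₁ + b y₂) t - (a y₁ + b y₂) s - ((b y₁ + a y₂) t - (b y₁ + a y₂) s) =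
            (G y₁ t - G y₂ t) - (G y₁ s - G y₂ s) := by
          simp only [StieltjesFunction.add_apply, ← hab]
          ring
        rw [e2]
        refine h3.trans_eq ?_
        rw [mul_sub]
        rfl
  · change ν y (Ioc s t) = _
    rw [hν y _ (isBddBorel_Ioc s t), StieltjesFunction.measureReal_Ioc _ hst,
      StieltjesFunction.measureReal_Ioc _ hst, ← hab, ← hab]
    ring

/-! ### Limits along an ultrafilter -/

variable {ι : Type*}

/-- About `(b - a) / d` consecutive intervals of length `d` cover `Ioc a b`, and their number does
not depend on `i`. Used with `d = 1` for bounded families and with a small `d` for equicontinuous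
ones. -/
theorem exists_measureReal_Ioc_le {μ : ι → Measure ℝ} {d c : ℝ} (hd : 0 < d)
    (h : ∀ i t, μ i (Icc t (t + d)) ≤ ENNReal.ofReal c) (a b : ℝ) :
    ∃ C : ℝ, ∀ i, (μ i).real (Ioc a b) ≤ C := by
  obtain ⟨n, hn⟩ := exists_nat_ge ((b - a) / d)
  refine ⟨(n * ENNReal.ofReal c).toReal, fun i => ENNReal.toReal_mono (by finiteness) ?_⟩
  have key : ∀ k : ℕ, μ i (Ioc a (a + k * d)) ≤ k * ENNReal.ofReal c := by
    intro k
    induction k with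
    | zero => simp
    | succ k ih =>
      have hsub : Ioc a (a + (k + 1 : ℕ) * d) ⊆
          Ioc a (a + k * d) ∪ Icc (a + k * d) (a + k * d + d) := by
        intro x hx
        push_cast at hx
        rcases le_or_gt x (a + k * d) with hxk | hxk
        · exact Or.inl ⟨hx.1, hxk⟩
        · exact Or.inr ⟨hxk.le, by linarith [hx.2]⟩
      refine (measure_mono hsub).trans ((measure_union_le _ _).trans ?_)
      push_cast
      rw [add_mul, one_mul]
      exact add_le_add ih (h i _)
  refine (measure_mono (Ioc_subset_Ioc_right ?_)).trans (key n)
  rw [div_le_iff₀ hd] at hn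
  linarith

/-- Boundedness gives a limit for every interval simultaneously, and additivity passes to limits, so
the limits are increments of one function. -/
theorem exists_tendsto_primitive (V : Ultrafilter ι) (f : ι → ℝ → ℝ → ℝ)
    (hf : ∀ i s t u, s ≤ t → t ≤ u → f i s u = f i s t + f i t u)
    (hC : ∀ a b, ∃ C, ∀ i, |f i a b| ≤ C) :
    ∃ F : ℝ → ℝ, ∀ s t, s ≤ t → Tendsto (fun i => f i s t) V (𝓝 (F t - F s)) := by
  choose C hC using hC
  choose g hg using fun s t => V.exists_tendsto_of_abs_le (fun i => f i s t) (C s t) (hC s t)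
  refine ⟨intervalPrimitive g, fun s t hst => ?_⟩
  rw [intervalPrimitive_sub (fun s t u h1 h2 => ?_) hst]
  · exact hg s t
  · refine tendsto_nhds_unique (hg s u) ?_
    simp only [hf _ s t u h1 h2]
    exact (hg s t).add (hg t u)

theorem BMeasure.Ioc_add (μ : BMeasure) {s t u : ℝ} (h₁ : s ≤ t) (h₂ : t ≤ u) :
    μ (Ioc s u) = μ (Ioc s t) + μ (Ioc t u) := by
  rw [← Ioc_union_Ioc_eq_Ioc h₁ h₂]
  exact μ.union (isBddBorel_Ioc _ _) (isBddBorel_Ioc _ _) (Ioc_disjoint_Ioc_of_le le_rfl)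

theorem measureReal_Ioc_add (m : Measure ℝ) [IsLocallyFiniteMeasure m] {s t u : ℝ} (h₁ : s ≤ t)
    (h₂ : t ≤ u) : m.real (Ioc s u) = m.real (Ioc s t) + m.real (Ioc t u) := by
  rw [← Ioc_union_Ioc_eq_Ioc h₁ h₂]
  exact measureReal_union_bdd m (isBddBorel_Ioc _ _) (isBddBorel_Ioc _ _)
    (Ioc_disjoint_Ioc_of_le le_rfl)

theorem EquicontinuousMeasures.exists_Ioc_bound {μ : ι → Measure ℝ}
    (h : EquicontinuousMeasures μ) (a b : ℝ) : ∃ C : ℝ, ∀ i, (μ i).real (Ioc a b) ≤ C := by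
  obtain ⟨δ, hδ, H⟩ := h 1 one_pos
  -- Half of `δ`, since equicontinuity controls only lengths strictly below `δ`.
  exact exists_measureReal_Ioc_le (half_pos hδ) (c := 1)
    (fun i t => (H i t _ (by linarith) (by linarith)).le) a b

theorem BoundedMeasures.exists_Ioc_bound {μ : ι → Measure ℝ}
    (h : BoundedMeasures μ) (a b : ℝ) : ∃ C : ℝ, ∀ i, (μ i).real (Ioc a b) ≤ C := by
  obtain ⟨c, -, hc⟩ := h
  exact exists_measureReal_Ioc_le one_pos hc a b

/-- The limits of the masses of intervals have a monotone primitive. -/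
theorem exists_tendsto_measureReal_Ioc (V : Ultrafilter ι) {μ : ι → Measure ℝ}
    (hμ : ∀ i, IsLocallyFiniteMeasure (μ i))
    (h : ∀ a b, ∃ C : ℝ, ∀ i, (μ i).real (Ioc a b) ≤ C) :
    ∃ F : ℝ → ℝ, Monotone F ∧
      ∀ s t, s ≤ t → Tendsto (fun i => (μ i).real (Ioc s t)) V (𝓝 (F t - F s)) := by
  obtain ⟨F, hF⟩ := exists_tendsto_primitive V (fun i s t => (μ i).real (Ioc s t))
    (fun i s t u h1 h2 => measureReal_Ioc_add (μ i) h1 h2)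
    (fun a b => by simpa only [abs_of_nonneg measureReal_nonneg] using h a b)
  exact ⟨F, fun s t hst => sub_nonneg.1 (ge_of_tendsto' (hF s t hst) fun i => measureReal_nonneg),
    hF⟩

/-- One `δ` serves all indices, so the smallness of short intervals survives in the limit, as a
non-strict inequality; hence the use of `ε / 2`. -/
theorem EquicontinuousMeasures.continuous_of_tendsto {V : Ultrafilter ι} {μ : ι → Measure ℝ}
    (h : EquicontinuousMeasures μ) {F : ℝ → ℝ} (hm : Monotone F)
    (hF : ∀ s t, s ≤ t → Tendsto (fun i => (μ i).real (Ioc s t)) V (𝓝 (F t - F s))) :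
    Continuous F := by
  refine Metric.continuous_iff.2 fun t ε hε => ?_
  obtain ⟨δ, hδ, H⟩ := h (ε / 2) (half_pos hε)
  have key : ∀ p q, p ≤ q → q - p < δ → F q - F p ≤ ε / 2 := fun p q hpq hd =>
    le_of_tendsto' (hF p q hpq) fun i => by
      refine ENNReal.toReal_le_of_le_ofReal (half_pos hε).le ?_
      exact (measure_mono Ioc_subset_Icc_self).trans (H i p q (sub_nonneg.2 hpq) hd).le
  refine ⟨δ, hδ, fun s hs => ?_⟩
  rw [Real.dist_eq] at hs ⊢
  rcases le_total s t with hst | hst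
  · have := key s t hst (by linarith [(abs_lt.1 hs).1])
    have := hm hst
    rw [abs_lt]; constructor <;> linarith
  · have := key t s hst (by linarith [(abs_lt.1 hs).2])
    have := hm hst
    rw [abs_lt]; constructor <;> linarith

/-- Parametric b-measures with equicontinuous `m`-bounds and bounded `l`-bounds converge on
intervals along every ultrafilter. -/
theorem ParamBMeasure.exists_tendsto_Ioc (V : Ultrafilter ι) {ν : ι → ParamBMeasure N ω}
    {m l : ι → ℕ+ → Measure ℝ} (hm : ∀ i j, IsMBound (ν i) j (m i j))
    (hme : ∀ j, EquicontinuousMeasures fun i => m i j) (hl : ∀ i j, IsLBound ω (ν i) j (l i j))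
    (hlb : ∀ j, BoundedMeasures fun i => l i j) :
    ∃ μ : ParamBMeasure N ω, ∀ y s t, s ≤ t →
      Tendsto (fun i => ν i y (Ioc s t)) V (𝓝 (μ y (Ioc s t))) := by
  -- Of the two limits, `F j` will be continuous by equicontinuity, whereas `H j` is only known to
  -- be monotone.
  choose F hFm hF using fun j => exists_tendsto_measureReal_Ioc V (fun i => (hm i j).1.1)
    (hme j).exists_Ioc_bound
  choose H hHm hH using fun j => exists_tendsto_measureReal_Ioc V (fun i => (hl i j).1.1)
    (hlb j).exists_Ioc_bound
  have hGex : ∀ y, ∃ G : ℝ → ℝ, ∀ s t, s ≤ t →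
      Tendsto (fun i => ν i y (Ioc s t)) V (𝓝 (G t - G s)) := fun y => by
    refine exists_tendsto_primitive V _ (fun i s t u => (ν i y).Ioc_add) fun a b => ?_
    obtain ⟨n, hn⟩ := exists_nat_ge ‖y‖
    obtain ⟨C, hC⟩ := (hme n.succPNat).exists_Ioc_bound a b
    refine ⟨C, fun i => (abs_apply_le (hm i n.succPNat) (isBddBorel_Ioc a b) ?_).trans (hC i)⟩
    refine hn.trans ?_
    simp
  choose G hG using hGex
  -- Both domination inequalities hold for each index and are preserved by limits along `V`.
  obtain ⟨μ, hμ⟩ := ParamBMeasure.exists_of_primitives (ω := ω) G F H hFm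
    (fun j => (hme j).continuous_of_tendsto (hFm j) (hF j)) hHm
    (fun j y hy s t hst => le_of_tendsto_of_tendsto' (hG y s t hst).abs (hF j s t hst)
      fun i => abs_apply_le (hm i j) (isBddBorel_Ioc s t) hy)
    (fun j y₁ y₂ h₁ h₂ s t hst => le_of_tendsto_of_tendsto'
      ((hG y₁ s t hst).sub (hG y₂ s t hst)).abs ((hH j s t hst).const_mul _)
      fun i => (abs_sub_apply_le (hl i j) (isBddBorel_Ioc s t) h₁ h₂).trans_eq (mul_comm _ _))
  exact ⟨μ, fun y s t hst => by rw [hμ y s t hst]; exact hG y s t hst⟩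

end

section


/-! ### Convergence in the topologies `σ_D` and `σ_Θ` -/

variable {N : ℕ} {ω : ModulusFamily} {ι : Type*}

theorem ParamBMeasure.sub_apply (ν₁ ν₂ : ParamBMeasure N ω) (y : EuclideanSpace ℝ (Fin N))
    (A : Set ℝ) : (ν₁ - ν₂) y A = ν₁ y A - ν₂ y A := rfl

theorem paramIntegral_sub (ν₁ ν₂ : ParamBMeasure N ω) {y : ℝ → EuclideanSpace ℝ (Fin N)}
    {a b : ℝ} (hab : a < b) (hy : ContinuousOn y (Icc a b)) :
    paramIntegral (ν₁ - ν₂) y a b = paramIntegral ν₁ y a b - paramIntegral ν₂ y a b := by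
  have e : ν₁ - ν₂ = ν₁ + (-1 : ℝ) • ν₂ := by rw [neg_one_smul, sub_eq_add_neg]
  rw [e, paramIntegral_add _ _ hab hy, paramIntegral_smul _ _ hab hy]
  ring

theorem tendsto_sigmaD {l : Filter ι} {ν : ι → ParamBMeasure N ω} {μ : ParamBMeasure N ω}
    (h : ∀ y s t, s ≤ t → Tendsto (fun i => ν i y (Ioc s t)) l (𝓝 (μ y (Ioc s t))))
    (D : Set (EuclideanSpace ℝ (Fin N))) : Tendsto ν l (@nhds _ (sigmaD N ω D) μ) := by
  refine tendsto_seminormTopology _ fun ⟨⟨y, _⟩, I⟩ => ?_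
  change Tendsto (fun i => |(ν i - μ) y (Icc (I.left : ℝ) I.right)|) l (𝓝 0)
  have := (h y _ _ I.lt_real.le).sub_const (μ y (Ioc (I.left : ℝ) I.right))
  simpa only [ParamBMeasure.sub_apply, BMeasure.Icc_eq_Ioc _ I.lt_real.le, sub_self, abs_zero]
    using this.abs

/-- The integral along a curve is close to the Riemann sums, with a rate that depends only on the
oscillation of the curve and on the `l`-bound. -/
theorem abs_paramIntegral_sub_riemannSum_le (ν : ParamBMeasure N ω) {j : ℕ+} {l : Measure ℝ}
    (hl : IsLBound ω ν j l) {y : ℝ → EuclideanSpace ℝ (Fin N)} {a b δ η : ℝ} (hab : a < b)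
    (hδ : 0 < δ) (hc : ContinuousOn y (Icc a b)) (hy : ∀ s ∈ Icc a b, ‖y s‖ ≤ (j : ℝ))
    (hη : ∀ s ∈ Icc a b, ∀ s' ∈ Icc a b, |s - s'| < 2 * δ → (ω j (nndist (y s) (y s')) : ℝ) ≤ η)
    {n : ℕ} {t τ : ℕ → ℝ} (hP : IsTaggedPartition δ a b n t τ) :
    |paramIntegral ν y a b - riemannSum ν y n t τ| ≤ η * l.real (Ioc a b) := by
  refine le_of_forall_pos_le_add fun ε hε => ?_
  obtain ⟨δ', hδ', H⟩ := hasParamIntegral_paramIntegral ν hab hc ε hε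
  obtain ⟨n', t', τ', hP'⟩ := exists_taggedPartition hab (lt_min hδ hδ')
  have h1 := H n' t' τ' (hP'.mono (min_le_right _ _))
  have h2 := abs_riemannSum_sub_le ν hl hy hη (hP'.mono (min_le_left _ _)) hP
  have := abs_sub_le (paramIntegral ν y a b) (riemannSum ν y n' t' τ') (riemannSum ν y n t τ)
  linarith

/-- Moving the value at one tag costs at most `η` times the `l`-mass of its cell, and the cells add
up to `Ioc a b`. This allows the values of all curves to be rounded to one finite set. -/
theorem abs_riemannSum_sub_sum_le (ν : ParamBMeasure N ω) {j : ℕ+} {l : Measure ℝ}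
    (hl : IsLBound ω ν j l) {y : ℝ → EuclideanSpace ℝ (Fin N)} {a b δ η : ℝ}
    (hy : ∀ s ∈ Icc a b, ‖y s‖ ≤ (j : ℝ)) {n : ℕ} {t τ : ℕ → ℝ}
    (hP : IsTaggedPartition δ a b n t τ) {z : ℕ → EuclideanSpace ℝ (Fin N)}
    (hz : ∀ k < n, ‖z k‖ ≤ (j : ℝ)) (hη : ∀ k < n, (ω j (nndist (y (τ k)) (z k)) : ℝ) ≤ η) :
    |riemannSum ν y n t τ - ∑ k ∈ Finset.range n, ν (z k) (Icc (t k) (t (k + 1)))| ≤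
      η * l.real (Ioc a b) := by
  have := hl.1.1
  have h1 := (sum_inter_Ioc (fun A B => measureReal_union_bdd l) (isBddBorel_Ioc a b) t n
    (fun i hi => (hP.2.2 i hi).1)).2
  rw [hP.1, hP.2.1, inter_self] at h1
  rw [h1, riemannSum, ← Finset.sum_sub_distrib, Finset.mul_sum]
  refine (Finset.abs_sum_le_sum_abs _ _).trans (Finset.sum_le_sum fun k hk => ?_)
  have hk := Finset.mem_range.1 hk
  have hlt := (hP.2.2 k hk).1
  have hsub : Ioc (t k) (t (k + 1)) ⊆ Ioc a b := Ioc_subset_Ioc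
    (hP.Icc_subset hk (left_mem_Icc.2 hlt.le)).1 (hP.Icc_subset hk (right_mem_Icc.2 hlt.le)).2
  rw [inter_eq_right.2 hsub, BMeasure.Icc_eq_Ioc _ hlt.le, BMeasure.Icc_eq_Ioc _ hlt.le, mul_comm]
  exact (abs_sub_apply_le hl (isBddBorel_Ioc _ _) (hy _ (hP.Icc_subset hk (hP.2.2 k hk).2.1))
    (hz k hk)).trans (mul_le_mul_of_nonneg_left (hη k hk) measureReal_nonneg)

theorem tendsto_sigmaTheta {f : Filter ι} {ν : ι → ParamBMeasure N ω} {μ : ParamBMeasure N ω}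
    (h : ∀ y s t, s ≤ t → Tendsto (fun i => ν i y (Ioc s t)) f (𝓝 (μ y (Ioc s t))))
    {l : ι → ℕ+ → Measure ℝ} (hl : ∀ i j, IsLBound ω (ν i) j (l i j))
    (hlb : ∀ j, BoundedMeasures fun i => l i j) (Θ : SuitableModuli) :
    Tendsto ν f (@nhds _ (sigmaTheta N ω Θ) μ) := by
  refine tendsto_seminormTopology _ fun ⟨I, j⟩ => ?_
  change Tendsto (fun i => ⨆ y : Θ.curves N I j,
    |paramIntegral (ν i - μ) y.1 I.left I.right|) f (𝓝 0)
  set a : ℝ := (I.left : ℝ)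
  set b : ℝ := (I.right : ℝ)
  have hab : a < b := I.lt_real
  obtain ⟨-, l₀, -, hl₀⟩ := μ.2 j
  obtain ⟨C₁, hC₁⟩ := (hlb j).exists_Ioc_bound a b
  set C := max (l₀.real (Ioc a b)) C₁
  have hC0 : 0 ≤ C := measureReal_nonneg.trans (le_max_left _ _)
  rw [Metric.tendsto_nhds]
  intro ε hε
  -- Replacing an integral by a Riemann sum, and then the tag values by net points, costs `η * C ≤ ε
  -- / 8` each. Doing so for both `ν i` and `μ` costs `ε / 2`; comparing the sums over the net costs
  -- `ε / 4`. The total `3 / 4 * ε` leaves room for the supremum, where strictness is lost.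
  set η : ℝ := ε / (8 * (C + 1)) with hηdef
  have hη0 : 0 < η := by positivity
  have hηC : η * C ≤ ε / 8 := by
    rw [hηdef, div_mul_eq_mul_div, div_le_div_iff₀ (by positivity) (by positivity)]
    nlinarith
  obtain ⟨ρ, hρ, Hρ⟩ : ∃ ρ > 0, ∀ r : ℝ≥0, (r : ℝ) < ρ → (ω j r : ℝ) ≤ η := by
    have h0 : Tendsto (fun r => (ω j r : ℝ)) (𝓝 0) (𝓝 0) := by
      have := (NNReal.continuous_coe.comp (ω.continuous j)).tendsto 0
      simpa [Function.comp_def, ω.zero j] using this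
    obtain ⟨ρ, hρ, H⟩ := Metric.eventually_nhds_iff.1 (h0.eventually (gt_mem_nhds hη0))
    exact ⟨ρ, hρ, fun r hr => (H (by simpa [NNReal.dist_eq] using hr)).le⟩
  -- Tags of overlapping cells of two partitions of mesh below `δ` are less than `2 * δ` apart.
  obtain ⟨δ, hδ, Hδ⟩ : ∃ δ > 0, ∀ r : ℝ≥0, (r : ℝ) < 2 * δ → (Θ I j r : ℝ) < ρ := by
    have h0 : Tendsto (fun r => (Θ I j r : ℝ)) (𝓝 0) (𝓝 0) := by
      have := (NNReal.continuous_coe.comp (Θ.continuous I j)).tendsto 0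
      simpa [Function.comp_def, Θ.zero I j] using this
    obtain ⟨δ, hδ, H⟩ := Metric.eventually_nhds_iff.1 (h0.eventually (gt_mem_nhds hρ))
    exact ⟨δ / 2, half_pos hδ, fun r hr => H (by
      rw [mul_div_cancel₀ δ two_ne_zero] at hr
      simpa [NNReal.dist_eq] using hr)⟩
  -- The partition and the net `Z` are fixed before any curve or index is chosen.
  obtain ⟨n, t, τ, hP⟩ := exists_taggedPartition hab hδ
  obtain ⟨Z, hZ, hZf, hZc⟩ := (isCompact_closedBall
    (0 : EuclideanSpace ℝ (Fin N)) (j : ℝ)).finite_cover_balls hρ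
  have hev : ∀ᶠ i in f, ∀ z ∈ Z, ∀ k ∈ Finset.range n,
      |ν i z (Icc (t k) (t (k + 1))) - μ z (Icc (t k) (t (k + 1)))| < ε / (4 * (n + 1)) := by
    refine (eventually_all_finite hZf).2 fun z _ => (Finset.eventually_all _).2 fun k hk => ?_
    have hlt := (hP.2.2 k (Finset.mem_range.1 hk)).1.le
    rw [BMeasure.Icc_eq_Ioc _ hlt]
    filter_upwards [Metric.tendsto_nhds.1 (h z _ _ hlt) (ε / (4 * (n + 1))) (by positivity)]
      with i hi
    rwa [BMeasure.Icc_eq_Ioc _ hlt]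
  filter_upwards [hev] with i hi
  have approx : ∀ (lam : ParamBMeasure N ω) (l' : Measure ℝ), IsLBound ω lam j l' →
      l'.real (Ioc a b) ≤ C → ∀ y ∈ Θ.curves N I j, ∀ z : ℕ → EuclideanSpace ℝ (Fin N),
      (∀ k < n, ‖z k‖ ≤ (j : ℝ) ∧ dist (y (τ k)) (z k) < ρ) →
      |paramIntegral lam y a b - ∑ k ∈ Finset.range n, lam (z k) (Icc (t k) (t (k + 1)))| ≤
        ε / 4 := by
    intro lam l' hl' hC' y hy z hz
    have h1 := abs_paramIntegral_sub_riemannSum_le lam hl' (η := η) hab hδ hy.1 hy.2.1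
      (fun s hs s' hs' hss => Hρ _ ((NNReal.coe_le_coe.2 (hy.2.2 s hs s' hs')).trans_lt
        (Hδ _ hss))) hP
    have h2 := abs_riemannSum_sub_sum_le lam hl' (η := η) hy.2.1 hP (fun k hk => (hz k hk).1)
      fun k hk => Hρ _ (hz k hk).2
    have h3 := mul_le_mul_of_nonneg_left hC' hη0.le
    have := abs_sub_le (paramIntegral lam y a b) (riemannSum lam y n t τ)
      (∑ k ∈ Finset.range n, lam (z k) (Icc (t k) (t (k + 1))))
    linarith
  have main : ∀ y : Θ.curves N I j, |paramIntegral (ν i - μ) y.1 a b| ≤ 3 / 4 * ε := by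
    rintro ⟨y, hy⟩
    -- Only the indices `k < n` matter; beyond them `0` is a filler.
    have hzex : ∀ k, ∃ z, k < n → z ∈ Z ∧ ‖z‖ ≤ (j : ℝ) ∧ dist (y (τ k)) z < ρ := fun k => by
      by_cases hk : k < n
      · have h1 : y (τ k) ∈ Metric.closedBall (0 : EuclideanSpace ℝ (Fin N)) (j : ℝ) :=
          mem_closedBall_zero_iff.2 (hy.2.1 _ (hP.Icc_subset hk (hP.2.2 k hk).2.1))
        obtain ⟨z, hz, hz'⟩ := mem_iUnion₂.1 (hZc h1)
        exact ⟨z, fun _ => ⟨hz, mem_closedBall_zero_iff.1 (hZ hz), hz'⟩⟩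
      · exact ⟨0, fun h => absurd h hk⟩
    choose z hz using hzex
    have h1 := approx (ν i) _ (hl i j) ((hC₁ i).trans (le_max_right _ _)) y hy z
      fun k hk => (hz k hk).2
    have h2 := approx μ _ hl₀ (le_max_left _ _) y hy z fun k hk => (hz k hk).2
    have h3 : |∑ k ∈ Finset.range n, ν i (z k) (Icc (t k) (t (k + 1))) -
        ∑ k ∈ Finset.range n, μ (z k) (Icc (t k) (t (k + 1)))| ≤ ε / 4 := by
      rw [← Finset.sum_sub_distrib]
      refine (Finset.abs_sum_le_sum_abs _ _).trans ((Finset.sum_le_card_nsmul _ _ _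
        fun k hk => (hi (z k) (hz k (Finset.mem_range.1 hk)).1 k hk).le).trans ?_)
      rw [Finset.card_range, nsmul_eq_mul, mul_div_assoc', div_le_div_iff₀ (by positivity)
        (by positivity)]
      nlinarith
    rw [paramIntegral_sub _ _ hab hy.1]
    rw [abs_le] at h1 h2 h3 ⊢
    constructor <;> linarith [h1.1, h1.2, h2.1, h2.2, h3.1, h3.2]
  rw [Real.dist_eq, sub_zero, abs_of_nonneg (Real.iSup_nonneg fun _ => abs_nonneg _)]
  exact (Real.iSup_le main (by positivity)).trans_lt (by linarith)

theorem IsSigmaTopology.regularSpace {T : TopologicalSpace (ParamBMeasure N ω)}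
    (hT : IsSigmaTopology T) : @RegularSpace _ T := by
  rcases hT with ⟨D, -, -, rfl⟩ | ⟨Θ, rfl⟩
  · exact regularSpace_seminormTopology _
  · exact regularSpace_seminormTopology _

theorem IsSigmaTopology.isCompact_closure {T : TopologicalSpace (ParamBMeasure N ω)}
    (hT : IsSigmaTopology T) {E : Set (ParamBMeasure N ω)} (hm : HasEquicontinuousMBounds E)
    (hl : HasBoundedLBounds E) : @IsCompact (ParamBMeasure N ω) T (closure[T] E) := by
  obtain ⟨m, hm, hme⟩ := hm
  obtain ⟨l, hl, hlb⟩ := hl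
  have := hT.regularSpace
  refine isCompact_closure_of_forall_ultrafilter fun V => ?_
  obtain ⟨μ, hμ⟩ := ParamBMeasure.exists_tendsto_Ioc V hm hme hl hlb
  refine ⟨μ, ?_⟩
  rcases hT with ⟨D, -, -, rfl⟩ | ⟨Θ, rfl⟩
  · exact tendsto_sigmaD hμ D
  · exact tendsto_sigmaTheta hμ hl hlb Θ

end

section


/-! ### Carathéodory vector fields as parametric b-measures -/

theorem IsBddBorel.integrableOn {f : ℝ → ℝ} (hf : LocallyIntegrable f volume) {A : Set ℝ}
    (hA : IsBddBorel A) : IntegrableOn f A volume :=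
  (hf.integrableOn_isCompact hA.2.isCompact_closure).mono_set subset_closure

/-- The measure with a given real density. -/
def densityMeasure (f : ℝ → ℝ) : Measure ℝ := volume.withDensity fun t => ENNReal.ofReal (f t)

theorem densityMeasure_apply {f : ℝ → ℝ} (hf : LocallyIntegrable f volume) (h0 : ∀ t, 0 ≤ f t)
    {A : Set ℝ} (hA : IsBddBorel A) : densityMeasure f A = ENNReal.ofReal (∫ t in A, f t) := by
  rw [densityMeasure, withDensity_apply _ hA.1,
    ofReal_integral_eq_lintegral_ofReal (hA.integrableOn hf) (Eventually.of_forall h0)]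

theorem isContinuousMeasure_densityMeasure {f : ℝ → ℝ} (hf : LocallyIntegrable f volume)
    (h0 : ∀ t, 0 ≤ f t) : IsContinuousMeasure (densityMeasure f) := by
  refine ⟨⟨fun x => ⟨Icc (x - 1) (x + 1), Icc_mem_nhds (by linarith) (by linarith), ?_⟩⟩,
    fun t => withDensity_absolutelyContinuous _ _ (measure_singleton t)⟩
  rw [densityMeasure_apply hf h0 (isBddBorel_Icc _ _)]
  exact ENNReal.ofReal_lt_top

theorem densityMeasure_Icc {f : ℝ → ℝ} (hf : LocallyIntegrable f volume) (h0 : ∀ t, 0 ≤ f t)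
    {s t : ℝ} (hst : s ≤ t) : densityMeasure f (Icc s t) = ENNReal.ofReal (∫ x in s..t, f x) := by
  rw [densityMeasure_apply hf h0 (isBddBorel_Icc _ _), integral_Icc_eq_integral_Ioc,
    intervalIntegral.integral_of_le hst]

namespace IsCaratheodory

variable {N : ℕ} {ω : ModulusFamily}
  {g : EuclideanSpace ℝ (Fin N) → ℝ → EuclideanSpace ℝ (Fin N)} {m l : ℕ+ → ℝ → ℝ}

theorem integrableOn (hg : IsCaratheodory ω g m l) (i : Fin N) (y : EuclideanSpace ℝ (Fin N))
    {A : Set ℝ} (hA : IsBddBorel A) : IntegrableOn (fun t => g y t i) A volume := by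
  obtain ⟨n, hn⟩ := exists_nat_ge ‖y‖
  have hy : ‖y‖ ≤ ((n.succPNat : ℕ+) : ℝ) := hn.trans (by simp)
  have hmeas : AEStronglyMeasurable (fun t => g y t i) volume :=
    ((EuclideanSpace.proj (𝕜 := ℝ) i).continuous.measurable.comp_aemeasurable
      (hg.measurable y)).aestronglyMeasurable
  refine (hA.integrableOn (hg.m_locallyIntegrable n.succPNat)).mono' hmeas.restrict ?_
  refine ae_restrict_of_ae ?_
  filter_upwards [hg.m_bound n.succPNat] with t ht
  exact (PiLp.norm_apply_le (g y t) i).trans (ht y hy)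

/-- The b-measure `A ↦ ∫_A g_i(y, t) dt`. -/
def bMeasure (hg : IsCaratheodory ω g m l) (i : Fin N) (y : EuclideanSpace ℝ (Fin N)) :
    BMeasure :=
  BMeasure.mk (fun A => ∫ t in A, g y t i) (by simp)
    (fun _ hA hd hU => hasSum_integral_iUnion (fun n => (hA n).1) hd (hg.integrableOn i y hU))
    (fun t => by simp [Measure.restrict_singleton])

theorem bMeasure_apply (hg : IsCaratheodory ω g m l) (i : Fin N) (y : EuclideanSpace ℝ (Fin N))
    {A : Set ℝ} (hA : IsBddBorel A) : hg.bMeasure i y A = ∫ t in A, g y t i :=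
  BMeasure.mk_apply hA

theorem isMBound (hg : IsCaratheodory ω g m l) (i : Fin N) (j : ℕ+) :
    IsMBound (hg.bMeasure i) j (densityMeasure (m j)) := by
  refine ⟨isContinuousMeasure_densityMeasure (hg.m_locallyIntegrable j) (hg.m_nonneg j),
    fun A _ y hy => BMeasure.variation_le (fun B hB => ?_) A⟩
  rw [densityMeasure_apply (hg.m_locallyIntegrable j) (hg.m_nonneg j) hB, hg.bMeasure_apply i y hB]
  rw [← Real.norm_eq_abs]
  refine ENNReal.ofReal_le_ofReal (norm_integral_le_of_norm_le
    (hB.integrableOn (hg.m_locallyIntegrable j)) (ae_restrict_of_ae ?_))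
  filter_upwards [hg.m_bound j] with t ht
  exact (PiLp.norm_apply_le (g y t) i).trans (ht y hy)

theorem isLBound (hg : IsCaratheodory ω g m l) (i : Fin N) (j : ℕ+) :
    IsLBound ω (hg.bMeasure i) j (densityMeasure (l j)) := by
  refine ⟨isContinuousMeasure_densityMeasure (hg.l_locallyIntegrable j) (hg.l_nonneg j),
    fun A _ y₁ y₂ h₁ h₂ => ?_⟩
  rw [mul_comm, ← smul_eq_mul, ← Measure.smul_apply]
  refine BMeasure.variation_le (fun B hB => ?_) A
  rw [Measure.smul_apply, smul_eq_mul, mul_comm,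
    densityMeasure_apply (hg.l_locallyIntegrable j) (hg.l_nonneg j) hB, BMeasure.sub_apply,
    hg.bMeasure_apply i _ hB, hg.bMeasure_apply i _ hB,
    ← integral_sub (hg.integrableOn i y₁ hB) (hg.integrableOn i y₂ hB),
    ← ENNReal.ofReal_coe_nnreal, ← ENNReal.ofReal_mul' (NNReal.coe_nonneg _),
    ← integral_mul_const]
  rw [← Real.norm_eq_abs]
  refine ENNReal.ofReal_le_ofReal (norm_integral_le_of_norm_le
    ((hB.integrableOn (hg.l_locallyIntegrable j)).mul_const _) (ae_restrict_of_ae ?_))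
  filter_upwards [hg.l_bound j] with t ht
  exact (PiLp.norm_apply_le (g y₁ t - g y₂ t) i).trans (ht y₁ y₂ h₁ h₂)

/-- The `i`-th component of a Carathéodory vector field as a parametric b-measure. -/
def paramBMeasure (hg : IsCaratheodory ω g m l) (i : Fin N) : ParamBMeasure N ω :=
  ⟨hg.bMeasure i, fun j => ⟨_, _, hg.isMBound i j, hg.isLBound i j⟩⟩

end IsCaratheodory

/-! ### Families of Carathéodory vector fields and products -/

variable {N : ℕ} {ω : ModulusFamily} {Γ : Type*}
  {g : Γ → EuclideanSpace ℝ (Fin N) → ℝ → EuclideanSpace ℝ (Fin N)} {m l : Γ → ℕ+ → ℝ → ℝ}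

theorem hasEquicontinuousMBounds_range (hg : ∀ α, IsCaratheodory ω (g α) (m α) (l α))
    (hm : ∀ j, ∀ ε : ℝ, 0 < ε → ∃ δ : ℝ, 0 < δ ∧ ∀ α s h, 0 ≤ h → h < δ →
      ∫ t in s..(s + h), m α j t < ε) (i : Fin N) :
    HasEquicontinuousMBounds (range fun α => (hg α).paramBMeasure i) := by
  -- Several `α` may give the same parametric b-measure, while bounds are indexed by the elements of
  -- the set. Any choice of `α` will do, because the hypothesis is uniform in `α`.
  choose a ha using fun ν : range fun α => (hg α).paramBMeasure i => ν.2
  refine ⟨fun ν j => densityMeasure (m (a ν) j), fun ν j => ?_, fun j ε hε => ?_⟩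
  · rw [← ha ν]
    exact (hg (a ν)).isMBound i j
  · obtain ⟨δ, hδ, H⟩ := hm j ε hε
    refine ⟨δ, hδ, fun ν s t h0 h1 => ?_⟩
    rw [densityMeasure_Icc ((hg _).m_locallyIntegrable j) ((hg _).m_nonneg j) (sub_nonneg.1 h0)]
    have := H (a ν) s (t - s) h0 h1
    rw [add_sub_cancel] at this
    exact (ENNReal.ofReal_lt_ofReal_iff hε).2 this

theorem hasBoundedLBounds_range (hg : ∀ α, IsCaratheodory ω (g α) (m α) (l α))
    (hl : ∀ j, ∃ c : ℝ, 0 < c ∧ ∀ α s, ∫ t in s..(s + 1), l α j t ≤ c) (i : Fin N) :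
    HasBoundedLBounds (range fun α => (hg α).paramBMeasure i) := by
  choose a ha using fun ν : range fun α => (hg α).paramBMeasure i => ν.2
  refine ⟨fun ν j => densityMeasure (l (a ν) j), fun ν j => ?_, fun j => ?_⟩
  · rw [← ha ν]
    exact (hg (a ν)).isLBound i j
  · obtain ⟨c, hc, H⟩ := hl j
    refine ⟨c, hc, fun ν t => ?_⟩
    rw [densityMeasure_Icc ((hg _).l_locallyIntegrable j) ((hg _).l_nonneg j) (by linarith)]
    exact ENNReal.ofReal_le_ofReal (H (a ν) t)

/-- The product of the closures of the coordinate ranges is compact by Tychonoff's theorem, is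
closed, and contains the range. -/
theorem isCompact_closure_range_pi {X κ α : Type*} [TopologicalSpace X] (f : α → κ → X)
    (h : ∀ k, IsCompact (closure (range fun a => f a k))) : IsCompact (closure (range f)) :=
  (isCompact_univ_pi h).of_isClosed_subset isClosed_closure
    (closure_minimal (by rintro _ ⟨a, rfl⟩ k -; exact subset_closure ⟨a, rfl⟩)
      (isClosed_set_pi fun _ _ => isClosed_closure))

end

end

/-! ### The compactness theorem -/

theorem mainTheorem1 (N : ℕ) (ω : ModulusFamily) (T : TopologicalSpace (ParamBMeasure N ω))
    (hT : IsSigmaTopology T) :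
    (∀ E : Set (ParamBMeasure N ω), HasEquicontinuousMBounds E → HasBoundedLBounds E →
      @IsCompact (ParamBMeasure N ω) T (closure[T] E)) ∧
    (∀ (Γ : Type*) (g : Γ → EuclideanSpace ℝ (Fin N) → ℝ → EuclideanSpace ℝ (Fin N)),
      IsBoundedCaratheodoryFamily ω g →
      ∃ ν : Γ → Fin N → ParamBMeasure N ω,
        (∀ α i y A, IsBddBorel A → ν α i y A = ∫ t in A, g α y t i) ∧
        @IsCompact (Fin N → ParamBMeasure N ω) (@Pi.topologicalSpace _ _ fun _ => T)
          (@closure _ (@Pi.topologicalSpace _ _ fun _ => T) (range ν))) := by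
  refine ⟨fun E hm hl => hT.isCompact_closure hm hl, fun Γ g ⟨m, l, hg, hm, hl⟩ => ?_⟩
  refine ⟨fun α i => (hg α).paramBMeasure i, fun α i y A hA => (hg α).bMeasure_apply i y hA, ?_⟩
  exact isCompact_closure_range_pi _ fun i => hT.isCompact_closure
    (hasEquicontinuousMBounds_range hg hm i) (hasBoundedLBounds_range hg hl i)
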